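/- Let $A$, $B$ be $C^*$-algebras (not necessarily unital) and let $V$ be a complex vector space with an $A$–$B$ bimodule structure (bilinear over $\mathbb C$, with $(av)b=a(vb)$), equipped with a norm $\|\cdot\|_n$ on $\mathbb M_n(V)$ for every $n\ge 1$; no completeness is required. Assume that the bimodule is essential: for every $n$, the matrices with entries in $\operatorname{span}\{avb : a\in A,\ v\in V,\ b\in B\}$ are dense in $(\mathbb M_n(V),\|\cdot\|_n)$. (If the norms form an operator space structure on $V$, it suffices that $\operatorname{span}(AVB)$ is dense in $V$.) Then the following two assertions are equivalent. (i) Ruan's axioms hold: for all $n,m\ge1$, $\tilde a\in\mathbb M_n(A)$, $\tilde b\in\mathbb M_n(B)$, $\tilde v\in\mathbb M_n(V)$, $\tilde w\in\mathbb M_m(V)$, $$\text{(R1)}\quad \|\tilde a\tilde v\tilde b\|_n\le\|\tilde a\|\,\|\tilde v\|_n\,\|\tilde b\|,\qquad \text{(R2)}\quad \left\|\begin{bmatrix}\tilde v&0\\0&\tilde w\end{bmatrix}\right\|_{n+m}=\max\{\|\tilde v\|_n,\|\tilde w\|_m\},$$ where $\mathbb M_n(A)$ and $\mathbb M_n(B)$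 carry their $C^*$-norms. (ii) There exist a Hilbert space $\mathfrak H$, two $*$-representations $\pi:A\to\mathcal B(\mathfrak H)$ and $\rho:B\to\mathcal B(\mathfrak H)$, and a linear map $J:V\to\mathcal B(\mathfrak H)$ that is completely isometric, i.e. $\|[J(v_{ij})]\|_{\mathcal B(\mathfrak H^n)}=\|[v_{ij}]\|_n$ for all $n\ge 1$ and $[v_{ij}]\in\mathbb M_n(V)$, and that is a morphism of bimodules, i.e. $J(av)=\pi(a)J(v)$ and $J(vb)=J(v)\rho(b)$, so that $$J(avb)=\pi(a)J(v)\rho(b)\qquad\text{for all } a\in A,\ v\in V,\ b\in B.$$ Moreover, if $A=B$, the equivalence remains true when one requires $\pi=\rho$ in (ii). -/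

import Mathlib

universe u v w

noncomputable section

namespace OperatorBimodule

/-- An `A`-`B` bimodule structure on the complex vector space `V`, for complex algebras `A` and `B`
that need not be unital. -/
structure Bimodule (A : Type u) (B : Type v) (V : Type w)
    [NonUnitalCStarAlgebra A] [NonUnitalCStarAlgebra B] [AddCommGroup V] [Module ℂ V] where
  /-- The left action `(a, x) ↦ a x`. -/
  left : A →ₗ[ℂ] V →ₗ[ℂ] V
  /-- The right action `(x, b) ↦ x b`. -/
  right : V →ₗ[ℂ] B →ₗ[ℂ] V
  mul_left : ∀ (a a' : A) (x : V), left (a * a') x = left a (left a' x)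
  right_mul : ∀ (x : V) (b b' : B), right x (b * b') = right (right x b) b'
  left_right : ∀ (a : A) (x : V) (b : B), right (left a x) b = left a (right x b)

/-- A norm `‖·‖ₙ` on each of the complex vector spaces `Mₙ(V)`; the norm of `V` itself is `‖·‖₁`.
(On `M₀(V) = 0` the norm is necessarily zero.) -/
structure MatrixNorms (V : Type w) [AddCommGroup V] [Module ℂ V] where
  norm : (n : ℕ) → Matrix (Fin n) (Fin n) V → ℝ
  norm_add_le : ∀ (n : ℕ) (x y : Matrix (Fin n) (Fin n) V), norm n (x + y) ≤ norm n x + norm n y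
  norm_smul : ∀ (n : ℕ) (c : ℂ) (x : Matrix (Fin n) (Fin n) V), norm n (c • x) = ‖c‖ * norm n x
  eq_zero_of_norm : ∀ (n : ℕ) (x : Matrix (Fin n) (Fin n) V), norm n x = 0 → x = 0

/-- The C⋆-norm of a matrix with entries in the C⋆-algebra `A`. Mathlib's norm on `CStarMatrix` asks
for the order of `A`, for which the usual order (`x ≤ y` iff `y - x` is positive) is supplied. -/
def cstarNorm {A : Type u} [NonUnitalCStarAlgebra A] {n : ℕ} (a : Matrix (Fin n) (Fin n) A) : ℝ :=
  letI : PartialOrder A := CStarAlgebra.spectralOrder A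
  letI : StarOrderedRing A := CStarAlgebra.spectralOrderedRing A
  ‖CStarMatrix.ofMatrix a‖

/-- The bounded operator on the Hilbert space `Hⁿ` given by a matrix of bounded operators on `H`. -/
def matrixOperator {H : Type u} [NormedAddCommGroup H] [InnerProductSpace ℂ H] {n : ℕ}
    (T : Matrix (Fin n) (Fin n) (H →L[ℂ] H)) :
    PiLp 2 (fun _ : Fin n => H) →L[ℂ] PiLp 2 (fun _ : Fin n => H) :=
  ((PiLp.continuousLinearEquiv 2 ℂ (fun _ : Fin n => H)).symm :
      (Fin n → H) →L[ℂ] PiLp 2 (fun _ : Fin n => H)) ∘L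
    (ContinuousLinearMap.pi fun i =>
      ∑ j, T i j ∘L (ContinuousLinearMap.proj j : (Fin n → H) →L[ℂ] H)) ∘L
    ((PiLp.continuousLinearEquiv 2 ℂ (fun _ : Fin n => H)) :
      PiLp 2 (fun _ : Fin n => H) →L[ℂ] (Fin n → H))

theorem matrixOperator_apply {H : Type u} [NormedAddCommGroup H] [InnerProductSpace ℂ H] {n : ℕ}
    (T : Matrix (Fin n) (Fin n) (H →L[ℂ] H)) (ξ : PiLp 2 (fun _ : Fin n => H)) (i : Fin n) :
    matrixOperator T ξ i = ∑ j, T i j (ξ j) := by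
  simp [matrixOperator]

/-- The block diagonal matrix with blocks `x` and `y`. -/
def blockDiag {V : Type w} [AddCommGroup V] {n m : ℕ}
    (x : Matrix (Fin n) (Fin n) V) (y : Matrix (Fin m) (Fin m) V) :
    Matrix (Fin (n + m)) (Fin (n + m)) V :=
  Matrix.reindex finSumFinEquiv finSumFinEquiv (Matrix.fromBlocks x 0 0 y)

section

variable {A : Type u} {B : Type v} {V : Type w}
  [NonUnitalCStarAlgebra A] [NonUnitalCStarAlgebra B] [AddCommGroup V] [Module ℂ V]

/-- The product `a x b` with `a ∈ Mₙ(A)`, `x ∈ Mₙ(V)`, `b ∈ Mₙ(B)`. -/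
def Bimodule.matMul (X : Bimodule A B V) {n : ℕ} (a : Matrix (Fin n) (Fin n) A)
    (x : Matrix (Fin n) (Fin n) V) (b : Matrix (Fin n) (Fin n) B) : Matrix (Fin n) (Fin n) V :=
  Matrix.of fun i j => ∑ k, ∑ l, X.right (X.left (a i k) (x k l)) (b l j)

/-- The linear span of the products `a x b` in `V`. -/
def Bimodule.essentialPart (X : Bimodule A B V) : Submodule ℂ V :=
  Submodule.span ℂ {y | ∃ (a : A) (x : V) (b : B), y = X.right (X.left a x) b}

/-- The bimodule is essential: the matrices with entries in the span of `A V B` (which are the sums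
of products `a x b` with `a ∈ Mₙ(A)`, `x ∈ Mₙ(V)`, `b ∈ Mₙ(B)`) are dense in `(Mₙ(V), ‖·‖ₙ)`.
When the norms form an operator space, where `‖x‖ₙ ≤ ∑ ‖xᵢⱼ‖₁`, this only has to be
asked for `n = 1`. -/
def IsEssential (X : Bimodule A B V) (N : MatrixNorms V) : Prop :=
  ∀ (n : ℕ) (x : Matrix (Fin n) (Fin n) V) (ε : ℝ), 0 < ε →
    ∃ y : Matrix (Fin n) (Fin n) V, (∀ i j, y i j ∈ X.essentialPart) ∧ N.norm n (x - y) < ε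

/-- Ruan's axiom (R1). -/
def RuanOne (X : Bimodule A B V) (N : MatrixNorms V) : Prop :=
  ∀ (n : ℕ) (a : Matrix (Fin n) (Fin n) A) (x : Matrix (Fin n) (Fin n) V)
    (b : Matrix (Fin n) (Fin n) B),
    N.norm n (X.matMul a x b) ≤ cstarNorm a * N.norm n x * cstarNorm b

/-- Ruan's axiom (R2). -/
def RuanTwo (N : MatrixNorms V) : Prop :=
  ∀ (n m : ℕ) (x : Matrix (Fin n) (Fin n) V) (y : Matrix (Fin m) (Fin m) V),
    N.norm (n + m) (blockDiag x y) = max (N.norm n x) (N.norm m y)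

/-- `J : V → B(H)` is completely isometric. -/
def IsCompletelyIsometric {H : Type*} [NormedAddCommGroup H] [InnerProductSpace ℂ H]
    (N : MatrixNorms V) (J : V →ₗ[ℂ] (H →L[ℂ] H)) : Prop :=
  ∀ (n : ℕ) (x : Matrix (Fin n) (Fin n) V), ‖matrixOperator (x.map J)‖ = N.norm n x

/-- `J : V → B(H)` is a morphism of bimodules, where `A` acts on `B(H)` on the left through `π`
and `B` acts on the right through `ρ`. -/
structure IsBimoduleMorphism {H : Type*} [NormedAddCommGroup H] [InnerProductSpace ℂ H]
    [CompleteSpace H] (X : Bimodule A B V) (π : A →⋆ₙₐ[ℂ] (H →L[ℂ] H))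
    (ρ : B →⋆ₙₐ[ℂ] (H →L[ℂ] H)) (J : V →ₗ[ℂ] (H →L[ℂ] H)) : Prop where
  map_left : ∀ (a : A) (x : V), J (X.left a x) = π a * J x
  map_right : ∀ (x : V) (b : B), J (X.right x b) = J x * ρ b
  map_left_right : ∀ (a : A) (x : V) (b : B), J (X.right (X.left a x) b) = π a * J x * ρ b

end

end OperatorBimodule

end

noncomputable section
namespace OperatorBimodule

open scoped InnerProductSpace

/-! A concrete bimodule of operators satisfies (R1) and (R2) because `*`-homomorphisms of
C⋆-algebras are contractive, also after amplification, and because a block diagonal operator acts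
separately on two orthogonal summands.

For the other direction, fix `v` in `Mₙ(V)` and a functional `F` of norm at most one with `F v =
‖v‖`. Ruan's axioms give `2 Re F(α⋆ x β) ≤ ‖α⋆α‖ + ‖β⋆β‖` for rectangular `α`, `β` and `‖x‖ ≤ 1`. By
(R2) the triples `(α⋆α, β⋆β, 2 Re F(α⋆ x β))` form a convex cone, so Hahn-Banach replaces the two
norms by positive functionals `P` on `Mₙ(A)` and `P'` on `Mₙ(B)`. Rescaling `α` and `β` turns the
sum into a product: `|F(α⋆ x β)| ≤ ‖x‖ P(α⋆α)^{1/2} P'(β⋆β)^{1/2}`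
(`exists_positiveLinearMaps_norm_sandwich_le`).

This inequality says that `F` induces a completely contractive bimodule map `J` from `V` to the
operators between the GNS spaces of `P'` and `P`. Essentiality and approximate units recover `F v`
from the values `F(e v f)`, so `J` does not decrease the norm of this `v` (`exists_bimoduleRep`).
The Hilbert sum over all `v` is completely isometric, and placing it in the upper right corner of
the operators on `H ⊕ K` yields a single Hilbert space. The unused diagonal entries are free, which
allows `π = ρ` when `A = B`. -/

theorem blockDiag_castAdd_castAdd {V : Type w} [AddCommGroup V] {n m : ℕ}
    (x : Matrix (Fin n) (Fin n) V) (y : Matrix (Fin m) (Fin m) V) (i j : Fin n) :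
    blockDiag x y (Fin.castAdd m i) (Fin.castAdd m j) = x i j := by
  simp [blockDiag]

theorem blockDiag_castAdd_natAdd {V : Type w} [AddCommGroup V] {n m : ℕ}
    (x : Matrix (Fin n) (Fin n) V) (y : Matrix (Fin m) (Fin m) V) (i : Fin n) (j : Fin m) :
    blockDiag x y (Fin.castAdd m i) (Fin.natAdd n j) = 0 := by
  simp [blockDiag]

theorem blockDiag_natAdd_castAdd {V : Type w} [AddCommGroup V] {n m : ℕ}
    (x : Matrix (Fin n) (Fin n) V) (y : Matrix (Fin m) (Fin m) V) (i : Fin m) (j : Fin n) :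
    blockDiag x y (Fin.natAdd n i) (Fin.castAdd m j) = 0 := by
  simp [blockDiag]

theorem blockDiag_natAdd_natAdd {V : Type w} [AddCommGroup V] {n m : ℕ}
    (x : Matrix (Fin n) (Fin n) V) (y : Matrix (Fin m) (Fin m) V) (i j : Fin m) :
    blockDiag x y (Fin.natAdd n i) (Fin.natAdd n j) = y i j := by
  simp [blockDiag]

/-! ### Operator matrices and amplified representations -/

section MatrixOperator

variable {H : Type*} [NormedAddCommGroup H] [InnerProductSpace ℂ H]

theorem matrixOperator_add {n : ℕ} (S T : Matrix (Fin n) (Fin n) (H →L[ℂ] H)) :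
    matrixOperator (S + T) = matrixOperator S + matrixOperator T := by
  ext ξ i
  simp [matrixOperator_apply, Finset.sum_add_distrib]

theorem matrixOperator_smul {n : ℕ} (c : ℂ) (T : Matrix (Fin n) (Fin n) (H →L[ℂ] H)) :
    matrixOperator (c • T) = c • matrixOperator T := by
  ext ξ i
  simp [matrixOperator_apply, Finset.smul_sum]

theorem matrixOperator_mul {n : ℕ} (S T : Matrix (Fin n) (Fin n) (H →L[ℂ] H)) :
    matrixOperator (S * T) = matrixOperator S * matrixOperator T := by
  ext ξ i
  simp only [matrixOperator_apply, Matrix.mul_apply, sum_apply, map_sum,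
    mul_apply_eq_comp]
  exact Finset.sum_comm

theorem matrixOperator_star [CompleteSpace H] {n : ℕ} (T : Matrix (Fin n) (Fin n) (H →L[ℂ] H)) :
    matrixOperator (star T) = star (matrixOperator T) := by
  rw [ContinuousLinearMap.star_eq_adjoint, ContinuousLinearMap.eq_adjoint_iff]
  intro ξ η
  simp only [PiLp.inner_apply, matrixOperator_apply, sum_inner, inner_sum, Matrix.star_apply,
    ContinuousLinearMap.star_eq_adjoint, ContinuousLinearMap.adjoint_inner_left]
  exact Finset.sum_comm

/-- The representation of `Mₙ(A)` on `Hⁿ` given by a representation of `A` on `H`. -/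
def amplification [CompleteSpace H] {A : Type*} [NonUnitalCStarAlgebra A] [PartialOrder A]
    [StarOrderedRing A] (π : A →⋆ₙₐ[ℂ] (H →L[ℂ] H)) (n : ℕ) :
    CStarMatrix (Fin n) (Fin n) A →⋆ₙₐ[ℂ]
      (PiLp 2 (fun _ : Fin n => H) →L[ℂ] PiLp 2 (fun _ : Fin n => H)) where
  toFun a := matrixOperator (Matrix.of fun i j => π (a i j))
  map_smul' c a := by
    rw [MonoidHom.id_apply, ← matrixOperator_smul]
    congr 1
    ext1 i j
    simp
  map_zero' := by
    ext ξ i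
    simp [matrixOperator_apply, CStarMatrix.zero_apply]
  map_add' a b := by
    rw [← matrixOperator_add]
    congr 1
    ext1 i j
    simp
  map_mul' a b := by
    rw [← matrixOperator_mul]
    congr 1
    ext1 i j
    simp [CStarMatrix.mul_apply, Matrix.mul_apply]
  map_star' a := by
    rw [← matrixOperator_star]
    congr 1
    ext1 i j
    simpa [CStarMatrix.star_apply, Matrix.star_apply] using map_star π (a j i)

/-- The amplification is a `*`-homomorphism between C⋆-algebras, hence contractive. -/
theorem norm_matrixOperator_map_le [CompleteSpace H] {A : Type*} [NonUnitalCStarAlgebra A]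
    (π : A →⋆ₙₐ[ℂ] (H →L[ℂ] H)) {n : ℕ} (a : Matrix (Fin n) (Fin n) A) :
    ‖matrixOperator (a.map π)‖ ≤ cstarNorm a := by
  let _ : PartialOrder A := CStarAlgebra.spectralOrder A
  let _ : StarOrderedRing A := CStarAlgebra.spectralOrderedRing A
  exact NonUnitalStarAlgHom.norm_apply_le (amplification π n) (CStarMatrix.ofMatrix a)

end MatrixOperator

/-- The operator from `Kⁿ` to `Hⁿ` with matrix `(J (x i j))` is bounded by `C`. -/
def AmplifiedBound {V H K : Type*} [AddCommGroup V] [Module ℂ V]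
    [NormedAddCommGroup H] [InnerProductSpace ℂ H] [NormedAddCommGroup K] [InnerProductSpace ℂ K]
    (J : V →ₗ[ℂ] (K →L[ℂ] H)) {n : ℕ} (x : Matrix (Fin n) (Fin n) V) (C : ℝ) : Prop :=
  ∀ η : Fin n → K, ∑ k, ‖∑ l, J (x k l) (η l)‖ ^ 2 ≤ C ^ 2 * ∑ l, ‖η l‖ ^ 2

/-! ### Concrete bimodules satisfy Ruan's axioms -/

section Converse

variable {V : Type w} [AddCommGroup V] [Module ℂ V]
  {H : Type*} [NormedAddCommGroup H] [InnerProductSpace ℂ H]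

theorem norm_matrixOperator_le_iff (J : V →ₗ[ℂ] (H →L[ℂ] H)) {n : ℕ}
    (x : Matrix (Fin n) (Fin n) V) {C : ℝ} (hC : 0 ≤ C) :
    ‖matrixOperator (x.map J)‖ ≤ C ↔ AmplifiedBound J x C := by
  rw [ContinuousLinearMap.opNorm_le_iff hC]
  refine ⟨fun h η => ?_, fun h ξ => ?_⟩
  · have := h (WithLp.toLp 2 η)
    rw [← sq_le_sq₀ (by positivity) (by positivity), mul_pow, PiLp.norm_sq_eq_of_L2,
      PiLp.norm_sq_eq_of_L2] at this
    simpa [matrixOperator_apply] using this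
  · rw [← sq_le_sq₀ (by positivity) (by positivity), mul_pow, PiLp.norm_sq_eq_of_L2,
      PiLp.norm_sq_eq_of_L2]
    simpa [matrixOperator_apply] using h ξ

/-- Both sums split over the two blocks. Vectors padded by zero isolate one block; adding the two
inequalities gives the converse. -/
theorem amplifiedBound_blockDiag_iff (J : V →ₗ[ℂ] (H →L[ℂ] H)) {n m : ℕ}
    (x : Matrix (Fin n) (Fin n) V) (y : Matrix (Fin m) (Fin m) V) (C : ℝ) :
    AmplifiedBound J (blockDiag x y) C ↔ AmplifiedBound J x C ∧ AmplifiedBound J y C := by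
  simp only [AmplifiedBound, Fin.sum_univ_add, blockDiag_castAdd_castAdd, blockDiag_castAdd_natAdd,
    blockDiag_natAdd_castAdd, blockDiag_natAdd_natAdd, map_zero, zero_apply,
    Finset.sum_const_zero, add_zero, zero_add]
  refine ⟨fun h => ⟨fun η => ?_, fun η => ?_⟩, fun h η => ?_⟩
  · simpa using h (Fin.append η 0)
  · simpa using h (Fin.append 0 η)
  · rw [mul_add]
    exact add_le_add (h.1 _) (h.2 _)

theorem ruanTwo_of_isCompletelyIsometric {N : MatrixNorms V} {J : V →ₗ[ℂ] (H →L[ℂ] H)}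
    (hJ : IsCompletelyIsometric N J) : RuanTwo N := by
  intro n m x y
  rw [← hJ, ← hJ, ← hJ]
  refine eq_of_forall_ge_iff fun C => ?_
  by_cases hC : 0 ≤ C
  · rw [max_le_iff, norm_matrixOperator_le_iff J _ hC, norm_matrixOperator_le_iff J _ hC,
      norm_matrixOperator_le_iff J _ hC, amplifiedBound_blockDiag_iff]
  · exact iff_of_false
      (fun h => hC ((norm_nonneg (matrixOperator ((blockDiag x y).map J))).trans h))
      (fun h => hC ((norm_nonneg (matrixOperator (x.map J))).trans (max_le_iff.1 h).1))

theorem ruanOne_of_isCompletelyIsometric {A : Type u} {B : Type v} [NonUnitalCStarAlgebra A]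
    [NonUnitalCStarAlgebra B] [CompleteSpace H] {X : Bimodule A B V} {N : MatrixNorms V}
    {π : A →⋆ₙₐ[ℂ] (H →L[ℂ] H)} {ρ : B →⋆ₙₐ[ℂ] (H →L[ℂ] H)} {J : V →ₗ[ℂ] (H →L[ℂ] H)}
    (hJ : IsCompletelyIsometric N J) (hX : IsBimoduleMorphism X π ρ J) : RuanOne X N := by
  intro n a x b
  have h : (X.matMul a x b).map J = a.map π * x.map J * b.map ρ := by
    ext1 i j
    simp only [Bimodule.matMul, Matrix.map_apply, Matrix.of_apply, map_sum, hX.map_left_right,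
      Matrix.mul_apply, Finset.sum_mul]
    exact Finset.sum_comm
  rw [← hJ, ← hJ, h, matrixOperator_mul, matrixOperator_mul]
  refine (norm_mul_le _ _).trans (mul_le_mul ((norm_mul_le _ _).trans ?_)
    (norm_matrixOperator_map_le ρ b) (norm_nonneg _) ?_)
  · exact mul_le_mul_of_nonneg_right (norm_matrixOperator_map_le π a) (norm_nonneg _)
  · exact mul_nonneg ((norm_nonneg _).trans (norm_matrixOperator_map_le π a)) (norm_nonneg _)

end Converse

end OperatorBimodule
end

/-! ### Hahn-Banach separation and positive functionals -/

noncomputable section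
namespace OperatorBimodule

/-- Any linear `f` below the sublinear function `Θ z = inf (S (z + q.1) - q.2)` works: `q = 0` gives
`f ≤ S`, and `z = -q.1` gives `q.2 ≤ f q.1`. The cone property makes `Θ` sublinear, and `q.2 ≤ S
q.1` keeps it finite. -/
theorem exists_linear_le_of_cone {E : Type*} [AddCommGroup E] [Module ℝ E] (S : E → ℝ)
    (S_smul : ∀ c : ℝ, 0 < c → ∀ x, S (c • x) = c * S x) (S_add : ∀ x y, S (x + y) ≤ S x + S y)
    (Q : Set (E × ℝ)) (zero_mem : 0 ∈ Q) (add_mem : ∀ p ∈ Q, ∀ q ∈ Q, p + q ∈ Q)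
    (smul_mem : ∀ c : ℝ, 0 < c → ∀ q ∈ Q, c • q ∈ Q) (hQ : ∀ q ∈ Q, q.2 ≤ S q.1) :
    ∃ f : E →ₗ[ℝ] ℝ, (∀ x, f x ≤ S x) ∧ ∀ q ∈ Q, q.2 ≤ f q.1 := by
  have S_zero : S 0 = 0 := by
    have := S_smul 2 two_pos 0
    rw [smul_zero] at this
    linarith
  let Θ : E → ℝ := fun z => ⨅ q : Q, (S (z + q.1.1) - q.1.2)
  have bdd : ∀ z, BddBelow (Set.range fun q : Q => S (z + q.1.1) - q.1.2) := by
    refine fun z => ⟨-S (-z), ?_⟩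
    rintro _ ⟨q, rfl⟩
    have h := S_add (-z) (z + q.1.1)
    rw [neg_add_cancel_left] at h
    have := hQ q.1 q.2
    dsimp only
    linarith
  have Θ_le : ∀ z, ∀ q ∈ Q, Θ z ≤ S (z + q.1) - q.2 := fun z q hq => ciInf_le (bdd z) ⟨q, hq⟩
  have : Nonempty Q := ⟨⟨0, zero_mem⟩⟩
  have Θ_smul : ∀ c : ℝ, 0 < c → ∀ z, Θ (c • z) = c * Θ z := by
    have key : ∀ c : ℝ, 0 < c → ∀ z, Θ (c • z) ≤ c * Θ z := by
      intro c hc z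
      rw [Real.mul_iInf_of_nonneg hc.le]
      refine le_ciInf fun q => ?_
      have h := Θ_le (c • z) _ (smul_mem c hc q.1 q.2)
      simpa only [Prod.smul_fst, Prod.smul_snd, ← smul_add, S_smul c hc, smul_eq_mul,
        ← mul_sub] using h
    intro c hc z
    refine (key c hc z).antisymm ?_
    have h := key c⁻¹ (inv_pos.2 hc) (c • z)
    rw [inv_smul_smul₀ hc.ne'] at h
    calc c * Θ z ≤ c * (c⁻¹ * Θ (c • z)) := mul_le_mul_of_nonneg_left h hc.le
      _ = Θ (c • z) := by rw [mul_inv_cancel_left₀ hc.ne']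
  have Θ_add : ∀ y z, Θ (y + z) ≤ Θ y + Θ z := by
    intro y z
    refine le_ciInf_add_ciInf fun p q => ?_
    have h := Θ_le (y + z) _ (add_mem p.1 p.2 q.1 q.2)
    have h' := S_add (y + p.1.1) (z + q.1.1)
    rw [add_add_add_comm] at h'
    simp only [Prod.fst_add, Prod.snd_add] at h
    linarith
  have Θ_zero : 0 ≤ Θ 0 := le_ciInf fun q => by simpa using hQ q.1 q.2
  -- The functional is extended from the zero subspace, where the only requirement is `0 ≤ Θ 0`.
  obtain ⟨f, -, hf⟩ := exists_extension_of_le_sublinear (⊥ : E →ₗ.[ℝ] ℝ) Θ Θ_smul Θ_add (by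
    rintro ⟨x, hx⟩
    obtain rfl : x = 0 := (Submodule.mem_bot ℝ).1 hx
    have : (⟨0, hx⟩ : (⊥ : E →ₗ.[ℝ] ℝ).domain) = 0 := rfl
    rw [this, LinearPMap.map_zero]
    exact Θ_zero)
  refine ⟨f, fun x => (hf x).trans (by simpa using Θ_le x 0 zero_mem), fun q hq => ?_⟩
  have h := (hf (-q.1)).trans (Θ_le _ q hq)
  rw [neg_add_cancel, S_zero, map_neg] at h
  linarith

section PositiveFunctional

variable {A B : Type*} [NonUnitalCStarAlgebra A] [PartialOrder A] [StarOrderedRing A]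
  [NonUnitalCStarAlgebra B] [PartialOrder B] [StarOrderedRing B]

open scoped ComplexOrder

theorem exists_positiveLinearMap_of_selfAdjoint (f : selfAdjoint A →ₗ[ℝ] ℝ)
    (hf : ∀ x : selfAdjoint A, 0 ≤ (x : A) → 0 ≤ f x) :
    ∃ P : A →ₚ[ℂ] ℂ, ∀ x : selfAdjoint A, (P x).re = f x := by
  let g : A →ₗ[ℂ] ℂ := Module.Dual.extendRCLike (𝕜 := ℂ) (f ∘ₗ realPart)
  have hre : ∀ x : selfAdjoint A, (g x).re = f x := fun x => by
    refine (Module.Dual.re_extendRCLike_apply (𝕜 := ℂ) (f ∘ₗ realPart) (x : A)).trans ?_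
    rw [LinearMap.comp_apply]
    congr 1
    exact Subtype.ext x.2.coe_realPart
  have him : ∀ x : selfAdjoint A, (g x).im = 0 := fun x => by
    refine (Module.Dual.im_extendRCLike_apply (𝕜 := ℂ) (f ∘ₗ realPart) (x : A)).trans ?_
    simp [realPart_I_smul, x.2.imaginaryPart]
  refine ⟨PositiveLinearMap.mk₀ g fun x hx => ?_, hre⟩
  have hx' : IsSelfAdjoint x := .of_nonneg hx
  rw [Complex.nonneg_iff]
  exact ⟨(hf ⟨x, hx'⟩ hx).trans_eq (hre ⟨x, hx'⟩).symm, (him ⟨x, hx'⟩).symm⟩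

theorem exists_positiveLinearMaps_of_cone (Q : Set (A × B × ℝ)) (zero_mem : 0 ∈ Q)
    (add_mem : ∀ p ∈ Q, ∀ q ∈ Q, p + q ∈ Q) (smul_mem : ∀ c : ℝ, 0 < c → ∀ q ∈ Q, c • q ∈ Q)
    (nonneg : ∀ q ∈ Q, 0 ≤ q.1 ∧ 0 ≤ q.2.1) (hQ : ∀ q ∈ Q, q.2.2 ≤ ‖q.1‖ + ‖q.2.1‖) :
    ∃ (P : A →ₚ[ℂ] ℂ) (P' : B →ₚ[ℂ] ℂ), (∀ x, 0 ≤ x → (P x).re ≤ ‖x‖) ∧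
      (∀ y, 0 ≤ y → (P' y).re ≤ ‖y‖) ∧ ∀ q ∈ Q, q.2.2 ≤ (P q.1).re + (P' q.2.1).re := by
  obtain ⟨f, hf, hfQ⟩ := exists_linear_le_of_cone (E := selfAdjoint A × selfAdjoint B)
    (fun z => ‖z.1‖ + ‖z.2‖)
    (fun c hc z => by simp [norm_smul, abs_of_pos hc, mul_add])
    (fun y z => (add_le_add (norm_add_le y.1 z.1) (norm_add_le y.2 z.2)).trans_eq (by abel))
    -- The cone is made upward closed in its two algebra components. It then contains `((x, 0), 0)`
    -- and `((0, x), 0)` for `x ≥ 0`, which forces positivity of `f`; the norm bound survives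
    -- because the norm is monotone on positive elements.
    {z | ∃ q ∈ Q, q.1 ≤ z.1.1 ∧ q.2.1 ≤ z.1.2 ∧ z.2 = q.2.2}
    ⟨0, zero_mem, by simp⟩
    (by
      rintro y ⟨p, hp, hp1, hp2, hp3⟩ z ⟨q, hq, hq1, hq2, hq3⟩
      refine ⟨p + q, add_mem p hp q hq, ?_, ?_, ?_⟩
      · simpa using add_le_add hp1 hq1
      · simpa using add_le_add hp2 hq2
      · simp [hp3, hq3])
    (by
      rintro c hc z ⟨q, hq, hq1, hq2, hq3⟩
      refine ⟨c • q, smul_mem c hc q hq, ?_, ?_, ?_⟩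
      · simpa using smul_le_smul_of_nonneg_left hq1 hc.le
      · simpa using smul_le_smul_of_nonneg_left hq2 hc.le
      · simp [hq3])
    (by
      rintro z ⟨q, hq, hq1, hq2, hq3⟩
      rw [hq3]
      exact (hQ q hq).trans (add_le_add
        (CStarAlgebra.norm_le_norm_of_nonneg_of_le (nonneg q hq).1 hq1)
        (CStarAlgebra.norm_le_norm_of_nonneg_of_le (nonneg q hq).2 hq2)))
  obtain ⟨P, hP⟩ := exists_positiveLinearMap_of_selfAdjoint (f ∘ₗ LinearMap.inl ℝ _ _)
    fun x hx => hfQ ((x, 0), 0) ⟨0, zero_mem, by simpa using hx⟩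
  obtain ⟨P', hP'⟩ := exists_positiveLinearMap_of_selfAdjoint (f ∘ₗ LinearMap.inr ℝ _ _)
    fun x hx => hfQ ((0, x), 0) ⟨0, zero_mem, by simpa using hx⟩
  refine ⟨P, P', fun x hx => ?_, fun y hy => ?_, fun q hq => ?_⟩
  · rw [hP ⟨x, .of_nonneg hx⟩]
    simpa using hf (⟨x, .of_nonneg hx⟩, 0)
  · rw [hP' ⟨y, .of_nonneg hy⟩]
    simpa using hf (0, ⟨y, .of_nonneg hy⟩)
  · rw [hP ⟨q.1, .of_nonneg (nonneg q hq).1⟩, hP' ⟨q.2.1, .of_nonneg (nonneg q hq).2⟩,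
      LinearMap.comp_apply, LinearMap.comp_apply, ← map_add]
    simpa using hfQ ((⟨q.1, .of_nonneg (nonneg q hq).1⟩, ⟨q.2.1, .of_nonneg (nonneg q hq).2⟩),
      q.2.2) ⟨q, hq, le_rfl, le_rfl, rfl⟩

end PositiveFunctional

end OperatorBimodule
end

noncomputable section
namespace OperatorBimodule

/-! ### Norming functionals -/

section Norms

variable {V : Type w} [AddCommGroup V] [Module ℂ V] (N : MatrixNorms V)

theorem MatrixNorms.norm_zero (n : ℕ) : N.norm n 0 = 0 := by
  simpa using N.norm_smul n 0 0

theorem MatrixNorms.norm_neg {n : ℕ} (x : Matrix (Fin n) (Fin n) V) :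
    N.norm n (-x) = N.norm n x := by
  simpa using N.norm_smul n (-1) x

theorem MatrixNorms.norm_nonneg {n : ℕ} (x : Matrix (Fin n) (Fin n) V) : 0 ≤ N.norm n x := by
  have h := N.norm_add_le n x (-x)
  rw [add_neg_cancel, N.norm_zero, N.norm_neg] at h
  linarith

theorem MatrixNorms.exists_functional {n : ℕ} (x : Matrix (Fin n) (Fin n) V) :
    ∃ F : Matrix (Fin n) (Fin n) V →ₗ[ℂ] ℂ,
      (∀ y, ‖F y‖ ≤ N.norm n y) ∧ (F x).re = N.norm n x := by
  let _ : Norm (Matrix (Fin n) (Fin n) V) := ⟨N.norm n⟩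
  have core : NormedSpace.Core ℂ (Matrix (Fin n) (Fin n) V) :=
    { norm_nonneg := N.norm_nonneg
      norm_smul := N.norm_smul n
      norm_triangle := N.norm_add_le n
      norm_eq_zero_iff := fun y => ⟨N.eq_zero_of_norm n y, fun h => h ▸ N.norm_zero n⟩ }
  let _ : NormedAddCommGroup (Matrix (Fin n) (Fin n) V) := .ofCore core
  let _ : NormedSpace ℂ (Matrix (Fin n) (Fin n) V) := .ofCore core
  obtain ⟨F, hF, hFx⟩ := exists_dual_vector'' ℂ x
  refine ⟨F.toLinearMap, fun y => ?_, ?_⟩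
  · exact (F.le_of_opNorm_le hF y).trans_eq (one_mul _)
  · exact (congrArg Complex.re hFx).trans (Complex.ofReal_re _)

end Norms

/-! ### Gram matrices of rectangular matrices -/

section Gram

variable {A : Type u} [NonUnitalCStarAlgebra A]

/-- The matrix `α⋆ α ∈ Mₙ(A)` for the rectangular matrix `α` with rows `α k`. -/
def gram {n r : ℕ} (α : Fin r → Fin n → A) : CStarMatrix (Fin n) (Fin n) A :=
  CStarMatrix.ofMatrix (Matrix.of fun i j => ∑ k, star (α k i) * α k j)

theorem gram_apply {n r : ℕ} (α : Fin r → Fin n → A) (i j : Fin n) :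
    gram α i j = ∑ k, star (α k i) * α k j := rfl

/-- The square matrix with a single nonzero row, the first one. -/
def firstRow {n : ℕ} [NeZero n] (a : Fin n → A) : CStarMatrix (Fin n) (Fin n) A :=
  CStarMatrix.ofMatrix (Matrix.of fun i j => if i = 0 then a j else 0)

theorem firstRow_apply {n : ℕ} [NeZero n] (a : Fin n → A) (i j : Fin n) :
    firstRow a i j = if i = 0 then a j else 0 := rfl

theorem cstarMatrix_sum_apply {n : ℕ} {ι : Type*} (s : Finset ι)
    (x : ι → CStarMatrix (Fin n) (Fin n) A) (i j : Fin n) :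
    (∑ k ∈ s, x k) i j = ∑ k ∈ s, x k i j :=
  Matrix.sum_apply i j s x

/-- Each row is encoded as a square matrix, so that positivity can be read off in the C⋆-algebra
`Mₙ(A)`. -/
theorem gram_eq_sum {n r : ℕ} [NeZero n] (α : Fin r → Fin n → A) :
    gram α = ∑ k, star (firstRow (α k)) * firstRow (α k) := by
  ext i j
  simp [gram_apply, cstarMatrix_sum_apply, CStarMatrix.mul_apply, CStarMatrix.star_apply,
    firstRow_apply]

variable [PartialOrder A] [StarOrderedRing A]

theorem gram_nonneg {n r : ℕ} [NeZero n] (α : Fin r → Fin n → A) : 0 ≤ gram α := by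
  rw [gram_eq_sum]
  exact Finset.sum_nonneg fun k _ => star_mul_self_nonneg _

/-- Dropping all rows but the first decreases `x⋆x`, the difference being the square of the dropped
part. This lets GNS vectors, which are square matrices, stand for single rows. -/
theorem gram_le_sum {n r : ℕ} [NeZero n] (x : Fin r → CStarMatrix (Fin n) (Fin n) A) :
    gram (fun k => x k 0) ≤ ∑ k, star (x k) * x k := by
  rw [gram_eq_sum]
  refine Finset.sum_le_sum fun k _ => ?_
  rw [← sub_nonneg]
  have h : star (x k) * x k - star (firstRow (x k 0)) * firstRow (x k 0) =
      star (x k - firstRow (x k 0)) * (x k - firstRow (x k 0)) := by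
    -- Multiplication by the adjoint of a first-row matrix only sees row `0` of `x k`.
    have h' : star (firstRow (x k 0)) * x k = star (firstRow (x k 0)) * firstRow (x k 0) := by
      ext i j
      simp [CStarMatrix.mul_apply, CStarMatrix.star_apply, firstRow_apply, apply_ite star]
    have h'' := congrArg star h'
    rw [star_mul, star_mul, star_star] at h''
    rw [star_sub, sub_mul, mul_sub, mul_sub, h', h'']
    abel
  rw [h]
  exact star_mul_self_nonneg _

/-- The inclusion of `Mₙ(A)` in `Mₙ₊ᵣ(A)` as the upper left corner. -/
def cornerHom (A : Type u) [NonUnitalCStarAlgebra A] [PartialOrder A] [StarOrderedRing A]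
    (n r : ℕ) :
    CStarMatrix (Fin n) (Fin n) A →⋆ₙₐ[ℂ] CStarMatrix (Fin (n + r)) (Fin (n + r)) A where
  toFun x := CStarMatrix.ofMatrix (blockDiag (CStarMatrix.ofMatrix.symm x) 0)
  map_smul' c x := by
    ext i j
    refine Fin.addCases (fun i => ?_) (fun i => ?_) i <;>
      refine Fin.addCases (fun j => ?_) (fun j => ?_) j <;>
        simp [blockDiag]
  map_zero' := by
    ext i j
    refine Fin.addCases (fun i => ?_) (fun i => ?_) i <;>
      refine Fin.addCases (fun j => ?_) (fun j => ?_) j <;>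
        simp [blockDiag, CStarMatrix.zero_apply]
  map_add' x y := by
    ext i j
    refine Fin.addCases (fun i => ?_) (fun i => ?_) i <;>
      refine Fin.addCases (fun j => ?_) (fun j => ?_) j <;>
        simp [blockDiag]
  map_mul' x y := by
    ext i j
    refine Fin.addCases (fun i => ?_) (fun i => ?_) i <;>
      refine Fin.addCases (fun j => ?_) (fun j => ?_) j <;>
        simp [blockDiag, CStarMatrix.mul_apply, Fin.sum_univ_add]
  map_star' x := by
    ext i j
    refine Fin.addCases (fun i => ?_) (fun i => ?_) i <;>
      refine Fin.addCases (fun j => ?_) (fun j => ?_) j <;>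
        simp [blockDiag, CStarMatrix.star_apply]

/-- The square matrix with the rectangular block `α` in the lower left corner. -/
def lowerLeft {n r : ℕ} (α : Fin r → Fin n → A) : CStarMatrix (Fin (n + r)) (Fin (n + r)) A :=
  CStarMatrix.ofMatrix (Matrix.reindex finSumFinEquiv finSumFinEquiv
    (Matrix.fromBlocks 0 0 (Matrix.of α) 0))

theorem star_lowerLeft_mul_self {n r : ℕ} (α : Fin r → Fin n → A) :
    star (lowerLeft α) * lowerLeft α = cornerHom A n r (gram α) := by
  ext i j
  change _ = blockDiag (CStarMatrix.ofMatrix.symm (gram α)) 0 i j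
  refine Fin.addCases (fun i => ?_) (fun i => ?_) i <;>
    refine Fin.addCases (fun j => ?_) (fun j => ?_) j <;>
      simp [lowerLeft, blockDiag, CStarMatrix.mul_apply, Fin.sum_univ_add, CStarMatrix.star_apply,
        gram_apply]

/-- The C⋆-identity reduces this to contractivity of the `*`-homomorphism `cornerHom`. -/
theorem norm_lowerLeft_le {n r : ℕ} (α : Fin r → Fin n → A) :
    ‖lowerLeft α‖ ≤ √‖gram α‖ := by
  refine Real.le_sqrt_of_sq_le ?_
  rw [sq, ← CStarRing.norm_star_mul_self, star_lowerLeft_mul_self]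
  exact NonUnitalStarAlgHom.norm_apply_le _ _

end Gram

/-! ### Rectangular products and approximate units -/

section Sandwich

variable {A : Type u} {B : Type v} {V : Type w} [NonUnitalCStarAlgebra A]
  [NonUnitalCStarAlgebra B] [AddCommGroup V] [Module ℂ V] (X : Bimodule A B V)

/-- The product `α⋆ x β ∈ Mₙ(V)` for rectangular matrices with rows `α k` and `β k`. -/
def Bimodule.sandwich {n r : ℕ} (α : Fin r → Fin n → A) (x : Matrix (Fin r) (Fin r) V)
    (β : Fin r → Fin n → B) : Matrix (Fin n) (Fin n) V :=
  Matrix.of fun i j => ∑ k, ∑ l, X.right (X.left (star (α k i)) (x k l)) (β l j)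

/-- Padding to size `n + r` makes a rectangular product square, so that (R1) applies to it; (R2)
later removes the padding. -/
theorem Bimodule.blockDiag_sandwich {n r : ℕ} (α : Fin r → Fin n → A)
    (x : Matrix (Fin r) (Fin r) V) (β : Fin r → Fin n → B) :
    blockDiag (X.sandwich α x β) (0 : Matrix (Fin r) (Fin r) V) =
      X.matMul (CStarMatrix.ofMatrix.symm (star (lowerLeft α)))
        (blockDiag (0 : Matrix (Fin n) (Fin n) V) x) (CStarMatrix.ofMatrix.symm (lowerLeft β)) := by
  ext i j
  refine Fin.addCases (fun i => ?_) (fun i => ?_) i <;>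
    refine Fin.addCases (fun j => ?_) (fun j => ?_) j <;>
      simp [lowerLeft, blockDiag, Bimodule.matMul, Bimodule.sandwich, Fin.sum_univ_add,
        CStarMatrix.star_apply]

variable {X}

theorem Bimodule.matMul_matMul {n : ℕ} (a a' : CStarMatrix (Fin n) (Fin n) A)
    (x : Matrix (Fin n) (Fin n) V) (b' b : CStarMatrix (Fin n) (Fin n) B) :
    X.matMul (CStarMatrix.ofMatrix.symm a)
      (X.matMul (CStarMatrix.ofMatrix.symm a') x (CStarMatrix.ofMatrix.symm b'))
      (CStarMatrix.ofMatrix.symm b) =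
    X.matMul (CStarMatrix.ofMatrix.symm (a * a')) x (CStarMatrix.ofMatrix.symm (b' * b)) := by
  ext i j
  simp only [Bimodule.matMul, Matrix.of_apply, CStarMatrix.ofMatrix_symm_apply,
    CStarMatrix.mul_apply, map_sum, LinearMap.sum_apply, X.mul_left, X.right_mul, X.left_right]
  calc _ = ∑ k, ∑ k', ∑ l, ∑ l',
          X.left (a i k) (X.left (a' k k') (X.right (X.right (x k' l') (b' l' l)) (b l j))) := by
        refine Finset.sum_congr rfl fun k _ => ?_
        rw [Finset.sum_comm]
    _ = ∑ k', ∑ k, ∑ l', ∑ l,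
          X.left (a i k) (X.left (a' k k') (X.right (X.right (x k' l') (b' l' l)) (b l j))) := by
        rw [Finset.sum_comm]
        refine Finset.sum_congr rfl fun k' _ => Finset.sum_congr rfl fun k _ => ?_
        rw [Finset.sum_comm]
    _ = _ := by
        refine Finset.sum_congr rfl fun k' _ => ?_
        rw [Finset.sum_comm]
        refine Finset.sum_congr rfl fun l' _ => ?_
        rw [Finset.sum_comm]

theorem Bimodule.matMul_add_mid {n : ℕ} (a : Matrix (Fin n) (Fin n) A)
    (x y : Matrix (Fin n) (Fin n) V) (b : Matrix (Fin n) (Fin n) B) :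
    X.matMul a (x + y) b = X.matMul a x b + X.matMul a y b := by
  ext i j
  simp [Bimodule.matMul, Finset.sum_add_distrib]

theorem Bimodule.matMul_smul_mid {n : ℕ} (c : ℂ) (a : Matrix (Fin n) (Fin n) A)
    (x : Matrix (Fin n) (Fin n) V) (b : Matrix (Fin n) (Fin n) B) :
    X.matMul a (c • x) b = c • X.matMul a x b := by
  ext i j
  simp [Bimodule.matMul, Finset.smul_sum]

theorem Bimodule.matMul_sub_left {n : ℕ} (a a' : Matrix (Fin n) (Fin n) A)
    (x : Matrix (Fin n) (Fin n) V) (b : Matrix (Fin n) (Fin n) B) :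
    X.matMul (a - a') x b = X.matMul a x b - X.matMul a' x b := by
  ext i j
  simp [Bimodule.matMul, Finset.sum_sub_distrib]

theorem Bimodule.matMul_sub_right {n : ℕ} (a : Matrix (Fin n) (Fin n) A)
    (x : Matrix (Fin n) (Fin n) V) (b b' : Matrix (Fin n) (Fin n) B) :
    X.matMul a x (b - b') = X.matMul a x b - X.matMul a x b' := by
  ext i j
  simp [Bimodule.matMul, Finset.sum_sub_distrib]

/-- Matrices with entries in the span of `A V B` are thereby sums of triple products in `Mₙ`, on
which approximate units can be tested. -/
theorem Bimodule.matMul_single {n : ℕ} (i j : Fin n) (a : A) (x : V) (b : B) :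
    X.matMul (Matrix.single i i a) (Matrix.single i j x) (Matrix.single j j b) =
      Matrix.single i j (X.right (X.left a x) b) := by
  ext i' j'
  rw [Bimodule.matMul, Matrix.of_apply, Finset.sum_eq_single i, Finset.sum_eq_single j]
  · by_cases hi : i = i' <;> by_cases hj : j = j' <;> simp [Matrix.single, hi, hj]
  · intro l _ hl
    simp [Matrix.single, hl.symm]
  · simp
  · intro k _ hk
    simp [Matrix.single, hk.symm]
  · simp

variable {N : MatrixNorms V} [PartialOrder A] [StarOrderedRing A] [PartialOrder B]
  [StarOrderedRing B]

theorem norm_sandwich_le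
    (h1 : ∀ (n : ℕ) (a : Matrix (Fin n) (Fin n) A) (x : Matrix (Fin n) (Fin n) V)
      (b : Matrix (Fin n) (Fin n) B), N.norm n (X.matMul a x b) ≤
        ‖CStarMatrix.ofMatrix a‖ * N.norm n x * ‖CStarMatrix.ofMatrix b‖)
    (h2 : RuanTwo N) {n r : ℕ} (α : Fin r → Fin n → A) (x : Matrix (Fin r) (Fin r) V)
    (β : Fin r → Fin n → B) :
    N.norm n (X.sandwich α x β) ≤ √‖gram α‖ * N.norm r x * √‖gram β‖ := by
  have e1 := h2 n r (X.sandwich α x β) 0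
  have e2 := h2 n r 0 x
  rw [N.norm_zero, max_eq_left (N.norm_nonneg _)] at e1
  rw [N.norm_zero, max_eq_right (N.norm_nonneg _)] at e2
  rw [← e1, X.blockDiag_sandwich, ← e2]
  refine (h1 _ _ _ _).trans ?_
  have ha : ‖star (lowerLeft α)‖ ≤ √‖gram α‖ := (norm_star _).trans_le (norm_lowerLeft_le α)
  exact mul_le_mul (mul_le_mul_of_nonneg_right ha (N.norm_nonneg _)) (norm_lowerLeft_le β)
    (norm_nonneg _) (mul_nonneg (Real.sqrt_nonneg _) (N.norm_nonneg _))

open Filter Topology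

/-- The matrices `y` with `e y f → y` form a subspace. It contains every `a y b`, since `e a y b f -
a y b = (e a - a) y (b f) + a y (b f - b)` and (R1) bounds both terms. -/
theorem tendsto_norm_matMul_sub_self
    (h1 : ∀ (n : ℕ) (a : Matrix (Fin n) (Fin n) A) (x : Matrix (Fin n) (Fin n) V)
      (b : Matrix (Fin n) (Fin n) B), N.norm n (X.matMul a x b) ≤
        ‖CStarMatrix.ofMatrix a‖ * N.norm n x * ‖CStarMatrix.ofMatrix b‖)
    {n : ℕ} {l : Filter (CStarMatrix (Fin n) (Fin n) A)} (hl : l.IsIncreasingApproximateUnit)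
    {l' : Filter (CStarMatrix (Fin n) (Fin n) B)} (hl' : l'.IsIncreasingApproximateUnit)
    (x : Matrix (Fin n) (Fin n) V) (hx : ∀ i j, x i j ∈ X.essentialPart) :
    Tendsto (fun e : CStarMatrix (Fin n) (Fin n) A × CStarMatrix (Fin n) (Fin n) B =>
      N.norm n (X.matMul (CStarMatrix.ofMatrix.symm e.1) x (CStarMatrix.ofMatrix.symm e.2) - x))
      (l ×ˢ l') (𝓝 0) := by
  let T := fun y : Matrix (Fin n) (Fin n) V =>
    Tendsto (fun e : CStarMatrix (Fin n) (Fin n) A × CStarMatrix (Fin n) (Fin n) B =>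
      N.norm n (X.matMul (CStarMatrix.ofMatrix.symm e.1) y (CStarMatrix.ofMatrix.symm e.2) - y))
      (l ×ˢ l') (𝓝 0)
  have T_zero : T 0 := by
    have : ∀ (a : Matrix (Fin n) (Fin n) A) (b : Matrix (Fin n) (Fin n) B),
        X.matMul a 0 b = 0 := fun a b => by
      have := X.matMul_smul_mid 0 a 0 b
      rwa [zero_smul, zero_smul] at this
    simp only [T, this, sub_zero, N.norm_zero]
    exact tendsto_const_nhds
  have T_add : ∀ y z, T y → T z → T (y + z) := by
    intro y z hy hz
    refine squeeze_zero (fun _ => N.norm_nonneg _) (fun e => ?_) (by simpa using hy.add hz)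
    rw [Bimodule.matMul_add_mid, add_sub_add_comm]
    exact N.norm_add_le _ _ _
  have T_smul : ∀ (c : ℂ) y, T y → T (c • y) := by
    intro c y hy
    refine (by simpa using hy.const_mul ‖c‖ : Tendsto _ _ (𝓝 (0 : ℝ))).congr fun e => ?_
    rw [Bimodule.matMul_smul_mid, ← smul_sub, N.norm_smul]
  have T_matMul : ∀ (a : CStarMatrix (Fin n) (Fin n) A) y (b : CStarMatrix (Fin n) (Fin n) B),
      T (X.matMul (CStarMatrix.ofMatrix.symm a) y (CStarMatrix.ofMatrix.symm b)) := by
    intro a y b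
    have ta : Tendsto (fun e : CStarMatrix (Fin n) (Fin n) A × CStarMatrix (Fin n) (Fin n) B =>
        ‖e.1 * a - a‖) (l ×ˢ l') (𝓝 0) := by
      have := ((hl.tendsto_mul_right a).comp (tendsto_fst (g := l'))).sub_const a
      rw [sub_self] at this
      simpa using this.norm
    have tb : Tendsto (fun e : CStarMatrix (Fin n) (Fin n) A × CStarMatrix (Fin n) (Fin n) B =>
        ‖b * e.2 - b‖) (l ×ˢ l') (𝓝 0) := by
      have := ((hl'.tendsto_mul_left b).comp (tendsto_snd (f := l))).sub_const b
      rw [sub_self] at this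
      simpa using this.norm
    have nb : Tendsto (fun e : CStarMatrix (Fin n) (Fin n) A × CStarMatrix (Fin n) (Fin n) B =>
        ‖b * e.2‖) (l ×ˢ l') (𝓝 ‖b‖) :=
      ((hl'.tendsto_mul_left b).comp (tendsto_snd (f := l))).norm
    have key := ((ta.mul_const (N.norm n y)).mul nb).add ((tb.const_mul (‖a‖ * N.norm n y)))
    simp only [zero_mul, mul_zero, add_zero] at key
    refine squeeze_zero (fun _ => N.norm_nonneg _) (fun e => ?_) key
    have h : X.matMul (CStarMatrix.ofMatrix.symm e.1)
          (X.matMul (CStarMatrix.ofMatrix.symm a) y (CStarMatrix.ofMatrix.symm b))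
          (CStarMatrix.ofMatrix.symm e.2) -
          X.matMul (CStarMatrix.ofMatrix.symm a) y (CStarMatrix.ofMatrix.symm b) =
        X.matMul (CStarMatrix.ofMatrix.symm (e.1 * a - a)) y
            (CStarMatrix.ofMatrix.symm (b * e.2)) +
          X.matMul (CStarMatrix.ofMatrix.symm a) y (CStarMatrix.ofMatrix.symm (b * e.2 - b)) := by
      rw [Bimodule.matMul_matMul]
      change _ = X.matMul (CStarMatrix.ofMatrix.symm (e.1 * a) - CStarMatrix.ofMatrix.symm a) _ _ +
        X.matMul _ _ (CStarMatrix.ofMatrix.symm (b * e.2) - CStarMatrix.ofMatrix.symm b)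
      rw [Bimodule.matMul_sub_left, Bimodule.matMul_sub_right]
      abel
    rw [h]
    exact (N.norm_add_le _ _ _).trans (add_le_add (h1 _ _ _ _) (h1 _ _ _ _))
  have T_single : ∀ (i j : Fin n), ∀ y ∈ X.essentialPart, T (Matrix.single i j y) := by
    intro i j y hy
    induction hy using Submodule.span_induction with
    | mem y hy =>
      obtain ⟨a, z, b, rfl⟩ := hy
      rw [← Bimodule.matMul_single]
      exact T_matMul (CStarMatrix.ofMatrix (Matrix.single i i a)) _
        (CStarMatrix.ofMatrix (Matrix.single j j b))
    | zero => simpa using T_zero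
    | add y z _ _ hy hz =>
      rw [Matrix.single_add]
      exact T_add _ _ hy hz
    | smul c y _ hy =>
      rw [← Matrix.smul_single]
      exact T_smul _ _ hy
  change T x
  rw [Matrix.matrix_eq_sum_single x]
  refine Finset.sum_induction _ T T_add T_zero fun i _ => ?_
  exact Finset.sum_induction _ T T_add T_zero fun j _ => T_single i j _ (hx i j)

/-- An `ε / 3` argument: approximate `x` by `y` with entries in the essential part; by (R1), `e (x -
y) f` is no larger than `x - y`. -/
theorem exists_norm_sub_matMul_lt
    (h1 : ∀ (n : ℕ) (a : Matrix (Fin n) (Fin n) A) (x : Matrix (Fin n) (Fin n) V)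
      (b : Matrix (Fin n) (Fin n) B), N.norm n (X.matMul a x b) ≤
        ‖CStarMatrix.ofMatrix a‖ * N.norm n x * ‖CStarMatrix.ofMatrix b‖)
    (hX : IsEssential X N) {n : ℕ} (x : Matrix (Fin n) (Fin n) V) {ε : ℝ} (hε : 0 < ε) :
    ∃ (e : CStarMatrix (Fin n) (Fin n) A) (f : CStarMatrix (Fin n) (Fin n) B), ‖e‖ ≤ 1 ∧ ‖f‖ ≤ 1 ∧
      N.norm n (x - X.matMul (CStarMatrix.ofMatrix.symm e) x (CStarMatrix.ofMatrix.symm f)) < ε := by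
  obtain ⟨y, hy, hxy⟩ := hX n x (ε / 3) (by positivity)
  have hl := CStarAlgebra.increasingApproximateUnit (CStarMatrix (Fin n) (Fin n) A)
  have hl' := CStarAlgebra.increasingApproximateUnit (CStarMatrix (Fin n) (Fin n) B)
  have := hl.neBot
  have := hl'.neBot
  have ev := (tendsto_norm_matMul_sub_self h1 hl hl' y hy).eventually
    (gt_mem_nhds (show (0 : ℝ) < ε / 3 by positivity))
  have ev1 := (tendsto_fst (f := CStarAlgebra.approximateUnit (CStarMatrix (Fin n) (Fin n) A))
    (g := CStarAlgebra.approximateUnit (CStarMatrix (Fin n) (Fin n) B))).eventually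
      hl.eventually_norm
  have ev2 := (tendsto_snd (f := CStarAlgebra.approximateUnit (CStarMatrix (Fin n) (Fin n) A))
    (g := CStarAlgebra.approximateUnit (CStarMatrix (Fin n) (Fin n) B))).eventually
      hl'.eventually_norm
  obtain ⟨⟨e, f⟩, h, he, hf⟩ := (ev.and (ev1.and ev2)).exists
  refine ⟨e, f, he, hf, ?_⟩
  dsimp only at h he hf
  have h3 : N.norm n (X.matMul (CStarMatrix.ofMatrix.symm e) (x - y)
      (CStarMatrix.ofMatrix.symm f)) ≤ N.norm n (x - y) := by
    refine (h1 _ _ _ _).trans ?_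
    change ‖e‖ * _ * ‖f‖ ≤ _
    have := N.norm_nonneg (x - y)
    calc ‖e‖ * N.norm n (x - y) * ‖f‖ ≤ 1 * N.norm n (x - y) * 1 := by gcongr
      _ = _ := by ring
  have h4 : x - X.matMul (CStarMatrix.ofMatrix.symm e) x (CStarMatrix.ofMatrix.symm f) =
      (x - y) + (-(X.matMul (CStarMatrix.ofMatrix.symm e) y (CStarMatrix.ofMatrix.symm f) - y) +
        -X.matMul (CStarMatrix.ofMatrix.symm e) (x - y) (CStarMatrix.ofMatrix.symm f)) := by
    have : X.matMul (CStarMatrix.ofMatrix.symm e) x (CStarMatrix.ofMatrix.symm f) =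
        X.matMul (CStarMatrix.ofMatrix.symm e) y (CStarMatrix.ofMatrix.symm f) +
        X.matMul (CStarMatrix.ofMatrix.symm e) (x - y) (CStarMatrix.ofMatrix.symm f) := by
      rw [← Bimodule.matMul_add_mid, add_sub_cancel]
    rw [this]
    abel
  have h5 := N.norm_add_le n (x - y)
    (-(X.matMul (CStarMatrix.ofMatrix.symm e) y (CStarMatrix.ofMatrix.symm f) - y) +
        -X.matMul (CStarMatrix.ofMatrix.symm e) (x - y) (CStarMatrix.ofMatrix.symm f))
  have h6 := N.norm_add_le n
    (-(X.matMul (CStarMatrix.ofMatrix.symm e) y (CStarMatrix.ofMatrix.symm f) - y))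
    (-X.matMul (CStarMatrix.ofMatrix.symm e) (x - y) (CStarMatrix.ofMatrix.symm f))
  rw [N.norm_neg, N.norm_neg] at h6
  rw [h4]
  linarith

end Sandwich

end OperatorBimodule
end

/-! ### Positive functionals dominating a functional on `Mₙ(V)` -/

noncomputable section
namespace OperatorBimodule

open scoped InnerProductSpace ComplexOrder
open UniformSpace Filter Topology

theorem le_sqrt_mul_sqrt_of_forall_scaling {t a b : ℝ} (ha : 0 ≤ a) (hb : 0 ≤ b)
    (h : ∀ s : ℝ, 0 < s → 2 * t ≤ s * a + s⁻¹ * b) : t ≤ √a * √b := by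
  have key : ∀ ε : ℝ, 0 < ε → t ≤ (√a + ε) * (√b + ε) := by
    intro ε hε
    have hA : 0 < √a + ε := by positivity
    have hB : 0 < √b + ε := by positivity
    -- For positive `a` and `b` the optimal scaling is `√b / √a`; the shift by `ε` covers the case
    -- where one of them vanishes.
    have h1 := h ((√b + ε) / (√a + ε)) (by positivity)
    have h2 : (√b + ε) / (√a + ε) * a ≤ (√a + ε) * (√b + ε) := by
      rw [div_mul_eq_mul_div, div_le_iff₀ hA]
      nlinarith [Real.sq_sqrt ha, Real.sqrt_nonneg a, mul_pos hA hB,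
        mul_nonneg hB.le (mul_nonneg (Real.sqrt_nonneg a) hε.le), mul_nonneg hB.le (sq_nonneg ε)]
    have h3 : ((√b + ε) / (√a + ε))⁻¹ * b ≤ (√a + ε) * (√b + ε) := by
      rw [inv_div, div_mul_eq_mul_div, div_le_iff₀ hB]
      nlinarith [Real.sq_sqrt hb, Real.sqrt_nonneg b, mul_pos hA hB,
        mul_nonneg hA.le (mul_nonneg (Real.sqrt_nonneg b) hε.le), mul_nonneg hA.le (sq_nonneg ε)]
    linarith
  have lim : Tendsto (fun ε : ℝ => (√a + ε) * (√b + ε)) (𝓝[>] 0) (𝓝 (√a * √b)) := by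
    have : Continuous fun ε : ℝ => (√a + ε) * (√b + ε) := by fun_prop
    simpa using (this.tendsto 0).mono_left nhdsWithin_le_nhds
  exact ge_of_tendsto lim (eventually_nhdsWithin_of_forall key)

theorem exists_norm_eq_one_mul_eq_norm (z : ℂ) : ∃ c : ℂ, ‖c‖ = 1 ∧ c * z = ‖z‖ := by
  by_cases hz : z = 0
  · exact ⟨1, by simp, by simp [hz]⟩
  · refine ⟨(starRingEnd ℂ z) / ‖z‖, ?_, ?_⟩
    · simp [hz]
    · have : (‖z‖ : ℂ) ≠ 0 := by simpa using hz
      rw [div_mul_eq_mul_div, Complex.conj_mul', div_eq_iff this, sq]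

section GramAlgebra

variable {A : Type u} {B : Type v} {V : Type w} [NonUnitalCStarAlgebra A]
  [NonUnitalCStarAlgebra B] [AddCommGroup V] [Module ℂ V] (X : Bimodule A B V)

theorem gram_append {n r s : ℕ} (α : Fin r → Fin n → A) (α' : Fin s → Fin n → A) :
    gram (Fin.append α α') = gram α + gram α' := by
  ext i j
  simp [gram_apply, Fin.sum_univ_add]

theorem gram_smul {n r : ℕ} (c : ℂ) (α : Fin r → Fin n → A) :
    gram (c • α) = (starRingEnd ℂ c * c) • gram α := by
  ext i j
  simp [gram_apply, Finset.smul_sum, smul_smul, smul_mul_assoc, mul_smul_comm, mul_comm]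

theorem Bimodule.sandwich_append {n r s : ℕ} (α : Fin r → Fin n → A) (α' : Fin s → Fin n → A)
    (x : Matrix (Fin r) (Fin r) V) (y : Matrix (Fin s) (Fin s) V)
    (β : Fin r → Fin n → B) (β' : Fin s → Fin n → B) :
    X.sandwich (Fin.append α α') (blockDiag x y) (Fin.append β β') =
      X.sandwich α x β + X.sandwich α' y β' := by
  ext i j
  simp [Bimodule.sandwich, Fin.sum_univ_add, blockDiag]

theorem Bimodule.sandwich_smul_smul {n r : ℕ} (c d : ℂ) (α : Fin r → Fin n → A)
    (x : Matrix (Fin r) (Fin r) V) (β : Fin r → Fin n → B) :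
    X.sandwich (c • α) x (d • β) = (starRingEnd ℂ c * d) • X.sandwich α x β := by
  ext i j
  simp [Bimodule.sandwich, Finset.smul_sum, smul_smul, mul_comm]

theorem Bimodule.sandwich_smul {n r : ℕ} (c : ℂ) (α : Fin r → Fin n → A)
    (x : Matrix (Fin r) (Fin r) V) (β : Fin r → Fin n → B) :
    X.sandwich α (c • x) β = c • X.sandwich α x β := by
  ext i j
  simp [Bimodule.sandwich, Finset.smul_sum]

/-- The matrix `(aᵢ⋆ x bⱼ)`. -/
def Bimodule.rowSandwich {n : ℕ} (a : Fin n → A) (x : V) (b : Fin n → B) :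
    Matrix (Fin n) (Fin n) V :=
  Matrix.of fun i j => X.right (X.left (star (a i)) x) (b j)

theorem Bimodule.sandwich_eq_sum {n r : ℕ} (α : Fin r → Fin n → A)
    (x : Matrix (Fin r) (Fin r) V) (β : Fin r → Fin n → B) :
    X.sandwich α x β = ∑ k, ∑ l, X.rowSandwich (α k) (x k l) (β l) := by
  ext i j
  simp [Bimodule.sandwich, Bimodule.rowSandwich, Matrix.sum_apply]

end GramAlgebra

section Functionals

variable {A : Type u} {B : Type v} {V : Type w} [NonUnitalCStarAlgebra A]
  [NonUnitalCStarAlgebra B] [AddCommGroup V] [Module ℂ V] {X : Bimodule A B V}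
  {N : MatrixNorms V} [PartialOrder A] [StarOrderedRing A] [PartialOrder B] [StarOrderedRing B]

/-- This is the separation step: the bound by norms of Gram matrices becomes a bound by positive
functionals, uniformly in the number `r` of rows. -/
theorem exists_positiveLinearMaps_norm_sandwich_le
    (h1 : ∀ (n : ℕ) (a : Matrix (Fin n) (Fin n) A) (x : Matrix (Fin n) (Fin n) V)
      (b : Matrix (Fin n) (Fin n) B), N.norm n (X.matMul a x b) ≤
        ‖CStarMatrix.ofMatrix a‖ * N.norm n x * ‖CStarMatrix.ofMatrix b‖)
    (h2 : RuanTwo N) {n : ℕ} [NeZero n] (F : Matrix (Fin n) (Fin n) V →ₗ[ℂ] ℂ)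
    (hF : ∀ y, ‖F y‖ ≤ N.norm n y) :
    ∃ (P : CStarMatrix (Fin n) (Fin n) A →ₚ[ℂ] ℂ) (P' : CStarMatrix (Fin n) (Fin n) B →ₚ[ℂ] ℂ),
      (∀ x, 0 ≤ x → (P x).re ≤ ‖x‖) ∧ (∀ y, 0 ≤ y → (P' y).re ≤ ‖y‖) ∧
      ∀ (r : ℕ) (α : Fin r → Fin n → A) (x : Matrix (Fin r) (Fin r) V) (β : Fin r → Fin n → B),
        ‖F (X.sandwich α x β)‖ ≤ N.norm r x * √(P (gram α)).re * √(P' (gram β)).re := by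
  obtain ⟨P, P', hP, hP', hQ⟩ := exists_positiveLinearMaps_of_cone
    (A := CStarMatrix (Fin n) (Fin n) A) (B := CStarMatrix (Fin n) (Fin n) B)
    {q | ∃ (r : ℕ) (α : Fin r → Fin n → A) (x : Matrix (Fin r) (Fin r) V) (β : Fin r → Fin n → B),
      N.norm r x ≤ 1 ∧ q = (gram α, gram β, 2 * (F (X.sandwich α x β)).re)}
    (by
      -- The empty product, with `r = 0`, is the apex of the cone.
      refine ⟨0, 0, 0, 0, by simp [N.norm_zero], ?_⟩
      have e : ∀ i j, (X.sandwich (0 : Fin 0 → Fin n → A) 0 0) i j = 0 := fun i j => by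
        simp [Bimodule.sandwich]
      have e' : X.sandwich (0 : Fin 0 → Fin n → A) 0 0 = 0 := by ext i j; exact e i j
      rw [e']
      refine Prod.ext ?_ (Prod.ext ?_ (by simp))
      · ext i j; simp [gram_apply, CStarMatrix.zero_apply]
      · ext i j; simp [gram_apply, CStarMatrix.zero_apply])
    (by
      rintro _ ⟨r, α, x, β, hx, rfl⟩ _ ⟨s, α', y, β', hy, rfl⟩
      refine ⟨r + s, Fin.append α α', blockDiag x y, Fin.append β β', ?_, ?_⟩
      · rw [h2]
        exact max_le hx hy
      · rw [gram_append, gram_append, X.sandwich_append, map_add, Complex.add_re, mul_add]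
        rfl)
    (by
      rintro c hc _ ⟨r, α, x, β, hx, rfl⟩
      have e : starRingEnd ℂ ((√c : ℝ) : ℂ) * ((√c : ℝ) : ℂ) = (c : ℂ) := by
        rw [Complex.conj_ofReal, ← Complex.ofReal_mul, Real.mul_self_sqrt hc.le]
      refine ⟨r, ((√c : ℝ) : ℂ) • α, x, ((√c : ℝ) : ℂ) • β, hx, ?_⟩
      rw [gram_smul, gram_smul, X.sandwich_smul_smul, e, map_smul]
      refine Prod.ext ?_ (Prod.ext ?_ ?_)
      · exact (Complex.coe_smul c (gram α)).symm
      · exact (Complex.coe_smul c (gram β)).symm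
      · simp
        ring)
    (by
      rintro _ ⟨r, α, x, β, hx, rfl⟩
      exact ⟨gram_nonneg α, gram_nonneg β⟩)
    (by
      rintro _ ⟨r, α, x, β, hx, rfl⟩
      have h3 := (Complex.re_le_norm _).trans ((hF _).trans (norm_sandwich_le h1 h2 α x β))
      have h4 : √‖gram α‖ * N.norm r x * √‖gram β‖ ≤ √‖gram α‖ * 1 * √‖gram β‖ := by gcongr
      -- The arithmetic-geometric inequality makes the product bound additive, as the separation
      -- requires.
      have h5 := two_mul_le_add_sq √‖gram α‖ √‖gram β‖
      rw [Real.sq_sqrt (norm_nonneg _), Real.sq_sqrt (norm_nonneg _)] at h5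
      dsimp only
      linarith)
  refine ⟨P, P', hP, hP', ?_⟩
  have main : ∀ (r : ℕ) (α : Fin r → Fin n → A) (x : Matrix (Fin r) (Fin r) V)
      (β : Fin r → Fin n → B), N.norm r x ≤ 1 →
      ‖F (X.sandwich α x β)‖ ≤ √(P (gram α)).re * √(P' (gram β)).re := by
    intro r α x β hx
    have pα := (Complex.nonneg_iff.1 (P.map_nonneg (gram_nonneg α))).1
    have pβ := (Complex.nonneg_iff.1 (P'.map_nonneg (gram_nonneg β))).1
    refine le_sqrt_mul_sqrt_of_forall_scaling pα pβ fun s hs => ?_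
    obtain ⟨c, hc, hcz⟩ := exists_norm_eq_one_mul_eq_norm (F (X.sandwich α x β))
    have hr : 0 < √s := Real.sqrt_pos.2 hs
    -- The Gram matrices are scaled by `s` and `s⁻¹`, while `F` of the product is only multiplied by
    -- the phase `c`, which makes it equal to its modulus.
    have h3 := hQ _ ⟨r, ((√s : ℝ) : ℂ) • α, x, (((√s)⁻¹ : ℝ) * c : ℂ) • β, hx, rfl⟩
    have e1 : starRingEnd ℂ ((√s : ℝ) : ℂ) * ((√s : ℝ) : ℂ) = (s : ℂ) := by
      rw [Complex.conj_ofReal, ← Complex.ofReal_mul, Real.mul_self_sqrt hs.le]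
    have e2 : starRingEnd ℂ (((√s)⁻¹ : ℝ) * c : ℂ) * (((√s)⁻¹ : ℝ) * c : ℂ) = (s⁻¹ : ℝ) := by
      rw [Complex.conj_mul', norm_mul, hc, mul_one, Complex.norm_real, Real.norm_eq_abs, abs_inv,
        abs_of_pos hr, ← Complex.ofReal_pow, inv_pow, Real.sq_sqrt hs.le]
    have e3 : starRingEnd ℂ ((√s : ℝ) : ℂ) * (((√s)⁻¹ : ℝ) * c : ℂ) = c := by
      rw [Complex.conj_ofReal, ← mul_assoc, ← Complex.ofReal_mul, mul_inv_cancel₀ hr.ne',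
        Complex.ofReal_one, one_mul]
    dsimp only at h3
    rw [gram_smul, gram_smul, X.sandwich_smul_smul, e1, e2, e3, map_smul, map_smul, map_smul,
      smul_eq_mul, hcz, smul_eq_mul, smul_eq_mul, Complex.re_ofReal_mul, Complex.re_ofReal_mul,
      Complex.ofReal_re] at h3
    exact h3
  intro r α x β
  by_cases hx : N.norm r x = 0
  · obtain rfl := N.eq_zero_of_norm r x hx
    have := X.sandwich_smul 0 α 0 β
    rw [zero_smul, zero_smul] at this
    simp [this, hx]
  · have hx' : 0 < N.norm r x := (N.norm_nonneg x).lt_of_ne' hx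
    have h3 := main r α (((N.norm r x)⁻¹ : ℝ) • x : Matrix (Fin r) (Fin r) V) β (by
      rw [← Complex.coe_smul, N.norm_smul, Complex.norm_real, Real.norm_eq_abs, abs_inv,
        abs_of_pos hx', inv_mul_cancel₀ hx])
    rw [← Complex.coe_smul, X.sandwich_smul, map_smul, norm_smul, Complex.norm_real,
      Real.norm_eq_abs, abs_inv, abs_of_pos hx', inv_mul_le_iff₀ hx', ← mul_assoc] at h3
    exact h3

end Functionals

/-! ### Operators between completions from bounded sesquilinear forms -/

section Completion

variable {E F : Type*} [SeminormedAddCommGroup E] [InnerProductSpace ℂ E]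
  [SeminormedAddCommGroup F] [InnerProductSpace ℂ F]

theorem completion_ext_inner {z w : Completion E}
    (h : ∀ x : E, ⟪(x : Completion E), z⟫_ℂ = ⟪(x : Completion E), w⟫_ℂ) : z = w := by
  refine ext_inner_left ℂ fun t => ?_
  induction t using Completion.induction_on with
  | hp => exact isClosed_eq (by fun_prop) (by fun_prop)
  | ih x => exact h x

theorem completion_clm_ext {S T : Completion F →L[ℂ] Completion E}
    (h : ∀ (x : E) (y : F), ⟪(x : Completion E), S y⟫_ℂ = ⟪(x : Completion E), T y⟫_ℂ) :
    S = T := by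
  ext z
  induction z using Completion.induction_on with
  | hp => exact isClosed_eq (by fun_prop) (by fun_prop)
  | ih y => exact completion_ext_inner fun x => h x y

/-- For fixed `y`, the conjugate of `T y` is a bounded linear functional; Riesz represents it by a
vector that depends linearly and boundedly on `y`. -/
theorem exists_clm_of_sesquilinear (T : F →ₗ[ℂ] E →ₗ⋆[ℂ] ℂ) {C : ℝ} (hC : 0 ≤ C)
    (hT : ∀ y x, ‖T y x‖ ≤ C * ‖y‖ * ‖x‖) :
    ∃ S : Completion F →L[ℂ] Completion E,
      ∀ (x : E) (y : F), ⟪(x : Completion E), S y⟫_ℂ = T y x := by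
  have ex : ∀ y : F, ∃ z : Completion E,
      (∀ x : E, ⟪(x : Completion E), z⟫_ℂ = T y x) ∧ ‖z‖ ≤ C * ‖y‖ := by
    intro y
    let L : E →ₗ[ℂ] ℂ :=
      { toFun := fun x => starRingEnd ℂ (T y x)
        map_add' := fun x x' => by simp
        map_smul' := fun c x => by simp }
    let L' : E →L[ℂ] ℂ := L.mkContinuous (C * ‖y‖) fun x => by simpa [L] using hT y x
    let L'' : Completion E →L[ℂ] ℂ := L'.extend Completion.toComplL
    have hL : ∀ x : E, L'' x = starRingEnd ℂ (T y x) := fun x =>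
      ContinuousLinearMap.extend_eq L' (Completion.denseRange_coe)
        (Completion.isUniformInducing_coe E) x
    let z := (InnerProductSpace.toDual ℂ (Completion E)).symm L''
    have hz : ∀ x : E, ⟪(x : Completion E), z⟫_ℂ = T y x := fun x => by
      rw [← inner_conj_symm, InnerProductSpace.toDual_symm_apply, hL, Complex.conj_conj]
    refine ⟨z, hz, ?_⟩
    have hb : ∀ t : Completion E, ‖⟪t, z⟫_ℂ‖ ≤ C * ‖y‖ * ‖t‖ := by
      intro t
      induction t using Completion.induction_on with
      | hp => exact isClosed_le (by fun_prop) (by fun_prop)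
      | ih x =>
        rw [hz, Completion.norm_coe]
        exact hT y x
    -- Testing the bound on `z` itself gives `‖z‖² ≤ C ‖y‖ ‖z‖`.
    by_cases h0 : ‖z‖ = 0
    · rw [h0]
      positivity
    · have h3 := hb z
      rw [inner_self_eq_norm_sq_to_K, norm_pow] at h3
      simp only [Complex.coe_algebraMap, Complex.norm_real, norm_norm] at h3
      rw [sq] at h3
      exact le_of_mul_le_mul_right h3 (lt_of_le_of_ne (norm_nonneg z) (Ne.symm h0))
  choose S hS hS' using ex
  let S₁ : F →ₗ[ℂ] Completion E :=
    { toFun := S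
      map_add' := fun y y' => completion_ext_inner fun x => by simp [hS, inner_add_right]
      map_smul' := fun c y => completion_ext_inner fun x => by simp [hS, inner_smul_right] }
  let S₂ : F →L[ℂ] Completion E := S₁.mkContinuous C hS'
  refine ⟨S₂.extend Completion.toComplL, fun x y => ?_⟩
  have : S₂.extend Completion.toComplL (y : Completion F) = S y :=
    ContinuousLinearMap.extend_eq S₂ (Completion.denseRange_coe)
      (Completion.isUniformInducing_coe F) y
  rw [this, hS]

end Completion

end OperatorBimodule
end

-- Representations on GNS spaces

universe u' v'

noncomputable section
namespace OperatorBimodule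

open scoped InnerProductSpace ComplexOrder
open UniformSpace Filter Topology

section DiagonalHom

variable (A : Type u) [NonUnitalCStarAlgebra A]

/-- The embedding of `A` in `Mₙ(A)` as scalar diagonal matrices. -/
def diagonalHom (n : ℕ) : A →⋆ₙₐ[ℂ] CStarMatrix (Fin n) (Fin n) A where
  toFun a := CStarMatrix.ofMatrix (Matrix.diagonal fun _ => a)
  map_smul' c a := by
    ext i j
    simp [Matrix.diagonal_apply]
  map_zero' := by
    ext i j
    simp
  map_add' a b := by
    ext i j
    by_cases h : i = j <;> simp [h]
  map_mul' a b := by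
    ext i j
    simp [Matrix.diagonal_apply, CStarMatrix.mul_apply]
  map_star' a := by
    ext i j
    by_cases h : i = j
    · simp [CStarMatrix.star_apply, h]
    · simp [CStarMatrix.star_apply, h, Ne.symm h]

theorem diagonalHom_mul_apply {n : ℕ} (a : A) (x : CStarMatrix (Fin n) (Fin n) A) (i j : Fin n) :
    (diagonalHom A n a * x) i j = a * x i j := by
  rw [CStarMatrix.mul_apply]
  change ∑ k, Matrix.diagonal (fun _ => a) i k * x k j = _
  simp [Matrix.diagonal_apply]

end DiagonalHom

/-- A representation of the bimodule `V` by operators from a Hilbert space `K` to a Hilbert space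
`H`, with representations of `A` on `H` and of `B` on `K`. -/
structure BimoduleRep {A : Type u} {B : Type v} {V : Type w} [NonUnitalCStarAlgebra A]
    [NonUnitalCStarAlgebra B] [AddCommGroup V] [Module ℂ V] (X : Bimodule A B V) where
  H : Type u'
  K : Type v'
  [normedH : NormedAddCommGroup H]
  [normedK : NormedAddCommGroup K]
  [innerH : InnerProductSpace ℂ H]
  [innerK : InnerProductSpace ℂ K]
  [completeH : CompleteSpace H]
  [completeK : CompleteSpace K]
  π : A →⋆ₙₐ[ℂ] (H →L[ℂ] H)
  ρ : B →⋆ₙₐ[ℂ] (K →L[ℂ] K)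
  J : V →ₗ[ℂ] (K →L[ℂ] H)
  map_left : ∀ (a : A) (x : V), J (X.left a x) = π a ∘L J x
  map_right : ∀ (x : V) (b : B), J (X.right x b) = J x ∘L ρ b

attribute [instance] BimoduleRep.normedH BimoduleRep.normedK BimoduleRep.innerH BimoduleRep.innerK
  BimoduleRep.completeH BimoduleRep.completeK

section Estimate

variable {V H K : Type*} [AddCommGroup V] [Module ℂ V]
  [NormedAddCommGroup H] [InnerProductSpace ℂ H] [NormedAddCommGroup K] [InnerProductSpace ℂ K]

theorem norm_sum_inner_le {r : ℕ} (ξ η : Fin r → H) :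
    ‖∑ k, ⟪ξ k, η k⟫_ℂ‖ ≤ √(∑ k, ‖ξ k‖ ^ 2) * √(∑ k, ‖η k‖ ^ 2) := by
  refine (norm_sum_le _ _).trans ((Finset.sum_le_sum fun k _ => norm_inner_le_norm _ _).trans ?_)
  exact Real.sum_mul_le_sqrt_mul_sqrt _ _ _

theorem AmplifiedBound.norm_sum_inner_le {J : V →ₗ[ℂ] (K →L[ℂ] H)} {r : ℕ}
    {x : Matrix (Fin r) (Fin r) V} {C : ℝ} (hC : 0 ≤ C) (h : AmplifiedBound J x C)
    (ξ : Fin r → H) (η : Fin r → K) :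
    ‖∑ k, ⟪ξ k, ∑ l, J (x k l) (η l)⟫_ℂ‖ ≤ C * √(∑ k, ‖ξ k‖ ^ 2) * √(∑ l, ‖η l‖ ^ 2) := by
  refine (OperatorBimodule.norm_sum_inner_le _ _).trans ?_
  rw [mul_comm C, mul_assoc]
  refine mul_le_mul_of_nonneg_left ?_ (Real.sqrt_nonneg _)
  refine (Real.sqrt_le_sqrt (h η)).trans_eq ?_
  rw [Real.sqrt_mul (sq_nonneg C), Real.sqrt_sq hC]

/-- Taking for `ξ` the image of `η` gives `S ≤ C √S √(∑ ‖η l‖²)`, and `√S` cancels. -/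
theorem amplifiedBound_of_norm_sum_inner_le {J : V →ₗ[ℂ] (K →L[ℂ] H)} {r : ℕ}
    {x : Matrix (Fin r) (Fin r) V} {C : ℝ}
    (h : ∀ (ξ : Fin r → H) (η : Fin r → K), ‖∑ k, ⟪ξ k, ∑ l, J (x k l) (η l)⟫_ℂ‖ ≤
      C * √(∑ k, ‖ξ k‖ ^ 2) * √(∑ l, ‖η l‖ ^ 2)) : AmplifiedBound J x C := by
  intro η
  have h1 := h (fun k => ∑ l, J (x k l) (η l)) η
  set S := ∑ k, ‖∑ l, J (x k l) (η l)‖ ^ 2 with hS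
  have hS0 : 0 ≤ S := by positivity
  have h2 : ∑ k, ⟪∑ l, J (x k l) (η l), ∑ l, J (x k l) (η l)⟫_ℂ = (S : ℂ) := by
    simp only [inner_self_eq_norm_sq_to_K, hS]
    push_cast
    rfl
  rw [h2, Complex.norm_real, Real.norm_eq_abs, abs_of_nonneg hS0] at h1
  have hE : 0 ≤ ∑ l, ‖η l‖ ^ 2 := by positivity
  by_cases h0 : S = 0
  · rw [h0]
    positivity
  · have hpos : 0 < √S := Real.sqrt_pos.2 (lt_of_le_of_ne hS0 (Ne.symm h0))
    have h3 : √S ≤ C * √(∑ l, ‖η l‖ ^ 2) := by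
      refine le_of_mul_le_mul_left ?_ hpos
      rw [Real.mul_self_sqrt hS0]
      linarith
    calc S = √S ^ 2 := (Real.sq_sqrt hS0).symm
      _ ≤ (C * √(∑ l, ‖η l‖ ^ 2)) ^ 2 := by gcongr
      _ = _ := by rw [mul_pow, Real.sq_sqrt hE]

end Estimate

section Representation

variable {A : Type u} {B : Type v} {V : Type w} [NonUnitalCStarAlgebra A]
  [NonUnitalCStarAlgebra B] [AddCommGroup V] [Module ℂ V] {X : Bimodule A B V}
  {N : MatrixNorms V} [PartialOrder A] [StarOrderedRing A] [PartialOrder B] [StarOrderedRing B]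

theorem preGNS_sum_norm_sq {n r : ℕ} (P : CStarMatrix (Fin n) (Fin n) A →ₚ[ℂ] ℂ)
    (x : Fin r → P.PreGNS) :
    ∑ k, ‖x k‖ ^ 2 = (P (∑ k, star (P.ofPreGNS (x k)) * P.ofPreGNS (x k))).re := by
  rw [map_sum, Complex.re_sum]
  refine Finset.sum_congr rfl fun k _ => ?_
  rw [← P.preGNS_norm_sq, ← Complex.ofReal_pow, Complex.ofReal_re]

theorem sqrt_gram_le {n r : ℕ} [NeZero n] (P : CStarMatrix (Fin n) (Fin n) A →ₚ[ℂ] ℂ)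
    (x : Fin r → P.PreGNS) :
    √(P (gram fun k => P.ofPreGNS (x k) 0)).re ≤ √(∑ k, ‖x k‖ ^ 2) := by
  refine Real.sqrt_le_sqrt ?_
  rw [preGNS_sum_norm_sq]
  exact (Complex.le_def.1 (OrderHomClass.mono P (gram_le_sum fun k => P.ofPreGNS (x k)))).1

variable (X) in
/-- The form `(y, x) ↦ F (x₀ᵢ⋆ v y₀ⱼ)` on the GNS spaces of two functionals. -/
def gnsForm {n : ℕ} [NeZero n] (F : Matrix (Fin n) (Fin n) V →ₗ[ℂ] ℂ)
    (P : CStarMatrix (Fin n) (Fin n) A →ₚ[ℂ] ℂ) (P' : CStarMatrix (Fin n) (Fin n) B →ₚ[ℂ] ℂ)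
    (v : V) : P'.PreGNS →ₗ[ℂ] P.PreGNS →ₗ⋆[ℂ] ℂ :=
  LinearMap.mk₂'ₛₗ (RingHom.id ℂ) (starRingEnd ℂ)
    (fun y x => F (X.rowSandwich (P.ofPreGNS x 0) v (P'.ofPreGNS y 0)))
    (fun y y' x => by
      rw [← map_add]
      congr 1
      ext i j
      simp [Bimodule.rowSandwich])
    (fun c y x => by
      rw [RingHom.id_apply, ← map_smul]
      congr 1
      ext i j
      simp [Bimodule.rowSandwich])
    (fun y x x' => by
      rw [← map_add]
      congr 1
      ext i j
      simp [Bimodule.rowSandwich])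
    (fun c y x => by
      rw [← map_smul]
      congr 1
      ext i j
      simp [Bimodule.rowSandwich])

theorem gnsForm_apply {n : ℕ} [NeZero n] (F : Matrix (Fin n) (Fin n) V →ₗ[ℂ] ℂ)
    (P : CStarMatrix (Fin n) (Fin n) A →ₚ[ℂ] ℂ) (P' : CStarMatrix (Fin n) (Fin n) B →ₚ[ℂ] ℂ)
    (v : V) (y : P'.PreGNS) (x : P.PreGNS) :
    gnsForm X F P P' v y x = F (X.rowSandwich (P.ofPreGNS x 0) v (P'.ofPreGNS y 0)) := rfl

theorem exists_gnsOperator {n : ℕ} [NeZero n] (F : Matrix (Fin n) (Fin n) V →ₗ[ℂ] ℂ)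
    (P : CStarMatrix (Fin n) (Fin n) A →ₚ[ℂ] ℂ) (P' : CStarMatrix (Fin n) (Fin n) B →ₚ[ℂ] ℂ)
    (hF : ∀ (r : ℕ) (α : Fin r → Fin n → A) (x : Matrix (Fin r) (Fin r) V) (β : Fin r → Fin n → B),
      ‖F (X.sandwich α x β)‖ ≤ N.norm r x * √(P (gram α)).re * √(P' (gram β)).re) :
    ∃ J : V →ₗ[ℂ] (P'.GNS →L[ℂ] P.GNS), ∀ (v : V) (x : P.PreGNS) (y : P'.PreGNS),
      ⟪(x : P.GNS), J v y⟫_ℂ = F (X.rowSandwich (P.ofPreGNS x 0) v (P'.ofPreGNS y 0)) := by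
  have ex : ∀ v : V, ∃ S : P'.GNS →L[ℂ] P.GNS, ∀ (x : P.PreGNS) (y : P'.PreGNS),
      ⟪(x : P.GNS), S y⟫_ℂ = gnsForm X F P P' v y x := by
    intro v
    -- The case `r = 1` of `hF` bounds the form by the two GNS seminorms.
    refine exists_clm_of_sesquilinear _ (N.norm_nonneg (fun _ _ : Fin 1 => v)) fun y x => ?_
    have h := hF 1 (fun _ => P.ofPreGNS x 0) (fun _ _ => v) (fun _ => P'.ofPreGNS y 0)
    have e : X.sandwich (fun _ : Fin 1 => P.ofPreGNS x 0) (fun _ _ => v)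
        (fun _ => P'.ofPreGNS y 0) = X.rowSandwich (P.ofPreGNS x 0) v (P'.ofPreGNS y 0) := by
      ext i j
      simp [Bimodule.sandwich, Bimodule.rowSandwich]
    rw [e] at h
    have hx := sqrt_gram_le P (fun _ : Fin 1 => x)
    have hy := sqrt_gram_le P' (fun _ : Fin 1 => y)
    rw [Fin.sum_univ_one, Real.sqrt_sq (norm_nonneg _)] at hx hy
    refine h.trans ?_
    rw [mul_right_comm]
    have := N.norm_nonneg (fun _ _ : Fin 1 => v)
    gcongr
  choose S hS using ex
  refine ⟨{ toFun := S, map_add' := fun v v' => ?_, map_smul' := fun c v => ?_ }, hS⟩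
  · refine completion_clm_ext fun x y => ?_
    rw [hS, add_apply, inner_add_right, hS, hS]
    simp only [gnsForm_apply]
    rw [← map_add]
    congr 1
    ext i j
    simp [Bimodule.rowSandwich]
  · refine completion_clm_ext fun x y => ?_
    rw [hS, RingHom.id_apply, smul_apply, inner_smul_right, hS]
    simp only [gnsForm_apply]
    rw [← smul_eq_mul, ← map_smul]
    congr 1
    ext i j
    simp [Bimodule.rowSandwich]

theorem gnsOperator_inner_sum {n : ℕ} [NeZero n] {F : Matrix (Fin n) (Fin n) V →ₗ[ℂ] ℂ}
    {P : CStarMatrix (Fin n) (Fin n) A →ₚ[ℂ] ℂ} {P' : CStarMatrix (Fin n) (Fin n) B →ₚ[ℂ] ℂ}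
    {J : V →ₗ[ℂ] (P'.GNS →L[ℂ] P.GNS)} (hJ : ∀ (v : V) (x : P.PreGNS) (y : P'.PreGNS),
      ⟪(x : P.GNS), J v y⟫_ℂ = F (X.rowSandwich (P.ofPreGNS x 0) v (P'.ofPreGNS y 0)))
    {r : ℕ} (v : Matrix (Fin r) (Fin r) V) (x : Fin r → P.PreGNS) (y : Fin r → P'.PreGNS) :
    ∑ k, ⟪(x k : P.GNS), ∑ l, J (v k l) (y l)⟫_ℂ =
      F (X.sandwich (fun k => P.ofPreGNS (x k) 0) v (fun l => P'.ofPreGNS (y l) 0)) := by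
  simp only [inner_sum, hJ, X.sandwich_eq_sum, map_sum]

/-- On vectors from the pre-GNS spaces the pairing is one value `F (α⋆ v β)`, to which `hF` applies;
density and continuity do the rest. -/
theorem gnsOperator_amplifiedBound {n : ℕ} [NeZero n] {F : Matrix (Fin n) (Fin n) V →ₗ[ℂ] ℂ}
    {P : CStarMatrix (Fin n) (Fin n) A →ₚ[ℂ] ℂ} {P' : CStarMatrix (Fin n) (Fin n) B →ₚ[ℂ] ℂ}
    (hF : ∀ (r : ℕ) (α : Fin r → Fin n → A) (x : Matrix (Fin r) (Fin r) V) (β : Fin r → Fin n → B),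
      ‖F (X.sandwich α x β)‖ ≤ N.norm r x * √(P (gram α)).re * √(P' (gram β)).re)
    {J : V →ₗ[ℂ] (P'.GNS →L[ℂ] P.GNS)} (hJ : ∀ (v : V) (x : P.PreGNS) (y : P'.PreGNS),
      ⟪(x : P.GNS), J v y⟫_ℂ = F (X.rowSandwich (P.ofPreGNS x 0) v (P'.ofPreGNS y 0)))
    {r : ℕ} (v : Matrix (Fin r) (Fin r) V) : AmplifiedBound J v (N.norm r v) := by
  refine amplifiedBound_of_norm_sum_inner_le fun ξ η => ?_
  have dP : DenseRange (Pi.map fun (_ : Fin r) (x : P.PreGNS) => (x : P.GNS)) :=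
    DenseRange.piMap fun _ => Completion.denseRange_coe
  have dP' : DenseRange (Pi.map fun (_ : Fin r) (x : P'.PreGNS) => (x : P'.GNS)) :=
    DenseRange.piMap fun _ => Completion.denseRange_coe
  induction ξ using dP.induction_on with
  | hp => exact isClosed_le (by fun_prop) (by fun_prop)
  | ih x =>
    induction η using dP'.induction_on with
    | hp => exact isClosed_le (by fun_prop) (by fun_prop)
    | ih y =>
      simp only [Pi.map_apply, Completion.norm_coe]
      rw [gnsOperator_inner_sum hJ]
      refine (hF _ _ _ _).trans ?_
      have := N.norm_nonneg v
      exact mul_le_mul (mul_le_mul_of_nonneg_left (sqrt_gram_le P x) this) (sqrt_gram_le P' y)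
        (Real.sqrt_nonneg _) (by positivity)

/-- The action is explicit only on pre-GNS vectors, so `a` is moved to that side as `star a`. -/
theorem gns_diagonal_inner {n : ℕ} (P : CStarMatrix (Fin n) (Fin n) A →ₚ[ℂ] ℂ) (a : A)
    (x : P.PreGNS) (z : P.GNS) :
    ⟪(x : P.GNS), P.gnsNonUnitalStarAlgHom (diagonalHom A n a) z⟫_ℂ =
      ⟪((P.toPreGNS (diagonalHom A n (star a) * P.ofPreGNS x) : P.PreGNS) : P.GNS), z⟫_ℂ := by
  rw [← ContinuousLinearMap.adjoint_inner_left, ← ContinuousLinearMap.star_eq_adjoint,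
    ← map_star, ← map_star, PositiveLinearMap.gnsNonUnitalStarAlgHom_apply_coe]
  rfl

/-- The norm of the chosen `v` is attained in the limit: vectors of total norm at most one are built
from `e` and `f` so that the pairing equals `F (e v f)`, which is close to `F v = ‖v‖`. -/
theorem exists_bimoduleRep
    (h1 : ∀ (n : ℕ) (a : Matrix (Fin n) (Fin n) A) (x : Matrix (Fin n) (Fin n) V)
      (b : Matrix (Fin n) (Fin n) B), N.norm n (X.matMul a x b) ≤
        ‖CStarMatrix.ofMatrix a‖ * N.norm n x * ‖CStarMatrix.ofMatrix b‖)
    (h2 : RuanTwo N) (hX : IsEssential X N) {n : ℕ} [NeZero n] (v : Matrix (Fin n) (Fin n) V) :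
    ∃ R : BimoduleRep.{u, v, w, u, v} X,
      (∀ (r : ℕ) (x : Matrix (Fin r) (Fin r) V), AmplifiedBound R.J x (N.norm r x)) ∧
      ∀ C : ℝ, 0 ≤ C → AmplifiedBound R.J v C → N.norm n v ≤ C := by
  obtain ⟨F, hF, hFv⟩ := N.exists_functional v
  obtain ⟨P, P', hP, hP', hFP⟩ := exists_positiveLinearMaps_norm_sandwich_le h1 h2 F hF
  obtain ⟨J, hJ⟩ := exists_gnsOperator F P P' hFP
  refine ⟨{ H := P.GNS, K := P'.GNS
            π := P.gnsNonUnitalStarAlgHom.comp (diagonalHom A n)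
            ρ := P'.gnsNonUnitalStarAlgHom.comp (diagonalHom B n)
            J := J, map_left := fun a x => ?_, map_right := fun x b => ?_ },
    fun r x => gnsOperator_amplifiedBound hFP hJ x, fun C hC hb => ?_⟩
  · refine completion_clm_ext fun y z => ?_
    rw [hJ, ContinuousLinearMap.comp_apply, NonUnitalStarAlgHom.comp_apply, gns_diagonal_inner, hJ]
    congr 1
    ext i j
    simp [Bimodule.rowSandwich, diagonalHom_mul_apply, X.mul_left]
  · refine completion_clm_ext fun y z => ?_
    rw [hJ, ContinuousLinearMap.comp_apply, NonUnitalStarAlgHom.comp_apply,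
      PositiveLinearMap.gnsNonUnitalStarAlgHom_apply_coe, hJ]
    congr 1
    ext i j
    simp [Bimodule.rowSandwich, diagonalHom_mul_apply, X.right_mul, X.left_right]
  · refine le_of_forall_pos_lt_add fun ε hε => ?_
    obtain ⟨e, f, he, hf, hef⟩ := exists_norm_sub_matMul_lt h1 hX v hε
    -- The first row of `x k` is row `k` of `star e`, and that of `y l` is row `l` of `f`. The
    -- sandwich of `v` between them is then `e v f`, and the squares sum to `e e⋆` and `f⋆ f`.
    obtain ⟨x, hxe⟩ : ∃ x : Fin n → P.PreGNS,
        ∀ k, P.ofPreGNS (x k) = firstRow fun i => star (e i k) :=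
      ⟨fun k => P.toPreGNS (firstRow fun i => star (e i k)), fun k => rfl⟩
    obtain ⟨y, hyf⟩ : ∃ y : Fin n → P'.PreGNS, ∀ l, P'.ofPreGNS (y l) = firstRow fun j => f l j :=
      ⟨fun l => P'.toPreGNS (firstRow fun j => f l j), fun l => rfl⟩
    have hx : ∑ k, ‖x k‖ ^ 2 ≤ 1 := by
      have : ∑ k, star (P.ofPreGNS (x k)) * P.ofPreGNS (x k) = e * star e := by
        ext i j
        simp [hxe, cstarMatrix_sum_apply, CStarMatrix.mul_apply, CStarMatrix.star_apply,
          firstRow_apply]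
      rw [preGNS_sum_norm_sq, this]
      refine (hP _ (mul_star_self_nonneg e)).trans ?_
      rw [CStarRing.norm_self_mul_star]
      exact mul_le_one₀ he (norm_nonneg _) he
    have hy : ∑ l, ‖y l‖ ^ 2 ≤ 1 := by
      have : ∑ l, star (P'.ofPreGNS (y l)) * P'.ofPreGNS (y l) = star f * f := by
        ext i j
        simp [hyf, cstarMatrix_sum_apply, CStarMatrix.mul_apply, CStarMatrix.star_apply,
          firstRow_apply]
      rw [preGNS_sum_norm_sq, this]
      refine (hP' _ (star_mul_self_nonneg f)).trans ?_
      rw [CStarRing.norm_star_mul_self]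
      exact mul_le_one₀ hf (norm_nonneg _) hf
    have h3 := hb.norm_sum_inner_le hC (fun k => (x k : P.GNS)) (fun l => (y l : P'.GNS))
    have h4 : ∑ k, ⟪(x k : P.GNS), ∑ l, J (v k l) (y l)⟫_ℂ =
        F (X.matMul (CStarMatrix.ofMatrix.symm e) v (CStarMatrix.ofMatrix.symm f)) := by
      refine (gnsOperator_inner_sum hJ v x y).trans (congrArg F ?_)
      ext i j
      simp [hxe, hyf, Bimodule.sandwich, Bimodule.matMul, firstRow_apply]
    replace h3 := (congrArg norm h4).symm.le.trans h3
    simp only [Completion.norm_coe] at h3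
    have h5 : C * √(∑ k, ‖x k‖ ^ 2) * √(∑ l, ‖y l‖ ^ 2) ≤ C * 1 * 1 := by
      gcongr
      · exact Real.sqrt_le_one.2 hx
      · exact Real.sqrt_le_one.2 hy
    have h6 := (Complex.re_le_norm _).trans_lt ((hF _).trans_lt hef)
    rw [map_sub, Complex.sub_re, hFv] at h6
    have h7 := Complex.re_le_norm
      (F (X.matMul (CStarMatrix.ofMatrix.symm e) v (CStarMatrix.ofMatrix.symm f)))
    linarith

end Representation

end OperatorBimodule
end

noncomputable section
namespace OperatorBimodule

open scoped InnerProductSpace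

/-! ### Hilbert sums of representations -/

section HilbertSum

variable {ι : Type*} {E F : ι → Type*} [∀ i, NormedAddCommGroup (E i)]
  [∀ i, NormedAddCommGroup (F i)]

theorem lp_hasSum_norm_sq (f : lp E 2) : HasSum (fun i => ‖f i‖ ^ 2) (‖f‖ ^ 2) := by
  have h := lp.hasSum_norm (p := 2) (by norm_num) f
  simpa using h

theorem memlp_two_of_norm_le {C : ℝ} (f : lp E 2) (g : ∀ i, F i) (h : ∀ i, ‖g i‖ ≤ C * ‖f i‖) :
    Memℓp g 2 := by
  refine memℓp_gen ?_
  simp only [ENNReal.toReal_ofNat, Real.rpow_ofNat]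
  refine Summable.of_nonneg_of_le (fun i => sq_nonneg _) (fun i => ?_)
    ((lp_hasSum_norm_sq f).summable.mul_left (C ^ 2))
  rw [← mul_pow]
  exact pow_le_pow_left₀ (norm_nonneg _) (h i) 2

variable [∀ i, InnerProductSpace ℂ (E i)] [∀ i, InnerProductSpace ℂ (F i)]

/-- The operator between Hilbert sums given by a uniformly bounded family of operators. -/
def lpMap (T : ∀ i, E i →L[ℂ] F i) (C : ℝ) (hT : ∀ i, ‖T i‖ ≤ C) : lp E 2 →L[ℂ] lp F 2 :=
  LinearMap.mkContinuous
    { toFun := fun f => ⟨fun i => T i (f i),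
        memlp_two_of_norm_le f _ fun i => (T i).le_of_opNorm_le (hT i) (f i)⟩
      map_add' := fun f g => by
        ext i
        exact map_add (T i) (f i) (g i)
      map_smul' := fun c f => by
        ext i
        simp }
    -- For an empty index set `C` may be negative.
    |C| fun f => by
      rw [← sq_le_sq₀ (norm_nonneg _) (by positivity), mul_pow]
      refine hasSum_le (fun i => ?_) (lp_hasSum_norm_sq _)
        ((lp_hasSum_norm_sq f).mul_left (|C| ^ 2))
      rw [← mul_pow]
      exact pow_le_pow_left₀ (norm_nonneg _)
        ((T i).le_of_opNorm_le ((hT i).trans (le_abs_self C)) (f i)) 2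

theorem lpMap_apply (T : ∀ i, E i →L[ℂ] F i) (C : ℝ) (hT : ∀ i, ‖T i‖ ≤ C) (f : lp E 2) (i : ι) :
    lpMap T C hT f i = T i (f i) := rfl

/-- The Hilbert sum of a family of representations. -/
def lpRep {A : Type*} [NonUnitalCStarAlgebra A] [∀ i, CompleteSpace (E i)]
    (π : ∀ i, A →⋆ₙₐ[ℂ] (E i →L[ℂ] E i)) : A →⋆ₙₐ[ℂ] (lp E 2 →L[ℂ] lp E 2) where
  toFun a := lpMap (fun i => π i a) ‖a‖ fun i => NonUnitalStarAlgHom.norm_apply_le (π i) a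
  map_smul' c a := by
    ext f i
    simp [lpMap_apply]
  map_zero' := by
    ext f i
    simp [lpMap_apply]
  map_add' a b := by
    ext f i
    simp [lpMap_apply]
  map_mul' a b := by
    ext f i
    simp [lpMap_apply]
  map_star' a := by
    rw [ContinuousLinearMap.star_eq_adjoint, ContinuousLinearMap.eq_adjoint_iff]
    intro f g
    rw [lp.inner_eq_tsum, lp.inner_eq_tsum]
    refine tsum_congr fun i => ?_
    rw [lpMap_apply, lpMap_apply, map_star, ContinuousLinearMap.star_eq_adjoint,
      ContinuousLinearMap.adjoint_inner_left]

theorem AmplifiedBound.norm_apply_le {V H K : Type*} [AddCommGroup V] [Module ℂ V]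
    [NormedAddCommGroup H] [InnerProductSpace ℂ H] [NormedAddCommGroup K] [InnerProductSpace ℂ K]
    {J : V →ₗ[ℂ] (K →L[ℂ] H)} {C : ℝ} (hC : 0 ≤ C) {v : V}
    (h : AmplifiedBound J (fun _ _ : Fin 1 => v) C) : ‖J v‖ ≤ C := by
  refine ContinuousLinearMap.opNorm_le_bound _ hC fun z => ?_
  have := h fun _ => z
  simp only [Finset.univ_unique, Finset.sum_singleton, ← mul_pow] at this
  exact (sq_le_sq₀ (norm_nonneg _) (by positivity)).1 this

variable {V : Type*} [AddCommGroup V] [Module ℂ V]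

/-- The Hilbert sum of a family of linear maps into spaces of operators. -/
def lpLinear (J : ∀ i, V →ₗ[ℂ] (E i →L[ℂ] F i)) (C : V → ℝ) (hJ : ∀ i v, ‖J i v‖ ≤ C v) :
    V →ₗ[ℂ] (lp E 2 →L[ℂ] lp F 2) where
  toFun v := lpMap (fun i => J i v) (C v) fun i => hJ i v
  map_add' v w := by
    ext f i
    simp [lpMap_apply]
  map_smul' c v := by
    ext f i
    simp [lpMap_apply]

theorem lpLinear_apply (J : ∀ i, V →ₗ[ℂ] (E i →L[ℂ] F i)) (C : V → ℝ)
    (hJ : ∀ i v, ‖J i v‖ ≤ C v) (v : V) (f : lp E 2) (i : ι) :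
    lpLinear J C hJ v f i = J i v (f i) := rfl

/-- Vectors supported at one index recover each summand; conversely the squared inequalities add up
over the index set. -/
theorem amplifiedBound_lpLinear_iff (J : ∀ i, V →ₗ[ℂ] (E i →L[ℂ] F i)) (C : V → ℝ)
    (hJ : ∀ i v, ‖J i v‖ ≤ C v) {r : ℕ} (x : Matrix (Fin r) (Fin r) V) (D : ℝ) :
    AmplifiedBound (lpLinear J C hJ) x D ↔ ∀ i, AmplifiedBound (J i) x D := by
  classical
  have coord : ∀ (k : Fin r) (η : Fin r → lp E 2) (i : ι),
      (∑ l, lpLinear J C hJ (x k l) (η l)) i = ∑ l, J i (x k l) (η l i) := by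
    intro k η i
    rw [lp.coeFn_sum, Finset.sum_apply]
    rfl
  refine ⟨fun h i η => ?_, fun h η => ?_⟩
  · refine le_trans ?_ ((h fun l => lp.single 2 i (η l)).trans_eq ?_)
    · refine Finset.sum_le_sum fun k _ => pow_le_pow_left₀ (norm_nonneg _) ?_ 2
      refine le_trans (le_of_eq ?_) (lp.norm_apply_le_norm two_ne_zero _ i)
      rw [coord]
      simp
    · simp [lp.norm_single]
  · refine hasSum_le (fun i => ?_) (hasSum_sum fun k _ => lp_hasSum_norm_sq _)
      ((hasSum_sum fun l _ => lp_hasSum_norm_sq (η l)).mul_left (D ^ 2))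
    simpa only [coord] using h i fun l => η l i

end HilbertSum

/-! ### The corner of the operators on `H ⊕ K` -/

section OffDiagonal

theorem withLp_prod_ext {H K : Type*} {z z' : WithLp 2 (H × K)} (h : z.fst = z'.fst) (h' : z.snd = z'.snd) :
    z = z' :=
  (WithLp.equiv 2 (H × K)).injective (Prod.ext h h')

variable {H K : Type*} [NormedAddCommGroup H] [InnerProductSpace ℂ H] [NormedAddCommGroup K]
  [InnerProductSpace ℂ K]

/-- The operator on `H ⊕ K` with diagonal entries `S` and `T`. -/
def diagonalOp (S : H →L[ℂ] H) (T : K →L[ℂ] K) : WithLp 2 (H × K) →L[ℂ] WithLp 2 (H × K) :=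
  ((WithLp.prodContinuousLinearEquiv 2 ℂ H K).symm : H × K →L[ℂ] WithLp 2 (H × K)) ∘L
    (S.prodMap T) ∘L (WithLp.prodContinuousLinearEquiv 2 ℂ H K : WithLp 2 (H × K) →L[ℂ] H × K)

theorem diagonalOp_fst (S : H →L[ℂ] H) (T : K →L[ℂ] K) (z : WithLp 2 (H × K)) :
    (diagonalOp S T z).fst = S z.fst := rfl

theorem diagonalOp_snd (S : H →L[ℂ] H) (T : K →L[ℂ] K) (z : WithLp 2 (H × K)) :
    (diagonalOp S T z).snd = T z.snd := rfl

/-- The linear map into the operators on `H ⊕ K` with values in the upper right corner. -/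
def offDiagonal : (K →L[ℂ] H) →ₗ[ℂ] (WithLp 2 (H × K) →L[ℂ] WithLp 2 (H × K)) where
  toFun T := ((WithLp.prodContinuousLinearEquiv 2 ℂ H K).symm : H × K →L[ℂ] WithLp 2 (H × K)) ∘L
    (ContinuousLinearMap.inl ℂ H K ∘L T ∘L ContinuousLinearMap.snd ℂ H K) ∘L
      (WithLp.prodContinuousLinearEquiv 2 ℂ H K : WithLp 2 (H × K) →L[ℂ] H × K)
  map_add' S T := by
    ext z
    simp
  map_smul' c T := by
    ext z
    simp

/-- The direct sum of two representations. -/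
def diagonalRep [CompleteSpace H] [CompleteSpace K] {A : Type*} [NonUnitalCStarAlgebra A]
    (π : A →⋆ₙₐ[ℂ] (H →L[ℂ] H)) (ρ : A →⋆ₙₐ[ℂ] (K →L[ℂ] K)) :
    A →⋆ₙₐ[ℂ] (WithLp 2 (H × K) →L[ℂ] WithLp 2 (H × K)) where
  toFun a := diagonalOp (π a) (ρ a)
  map_smul' c a := by
    ext1 z
    refine withLp_prod_ext ?_ ?_ <;> simp [diagonalOp_fst, diagonalOp_snd]
  map_zero' := by
    ext1 z
    refine withLp_prod_ext ?_ ?_ <;> simp [diagonalOp_fst, diagonalOp_snd]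
  map_add' a b := by
    ext1 z
    refine withLp_prod_ext ?_ ?_ <;> simp [diagonalOp_fst, diagonalOp_snd]
  map_mul' a b := by
    ext1 z
    refine withLp_prod_ext ?_ ?_ <;> simp [diagonalOp_fst, diagonalOp_snd]
  map_star' a := by
    rw [ContinuousLinearMap.star_eq_adjoint, ContinuousLinearMap.eq_adjoint_iff]
    intro y z
    rw [WithLp.prod_inner_apply, WithLp.prod_inner_apply]
    change ⟪π (star a) y.fst, z.fst⟫_ℂ + ⟪ρ (star a) y.snd, z.snd⟫_ℂ =
      ⟪y.fst, π a z.fst⟫_ℂ + ⟪y.snd, ρ a z.snd⟫_ℂ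
    rw [map_star, map_star, ContinuousLinearMap.star_eq_adjoint,
      ContinuousLinearMap.star_eq_adjoint, ContinuousLinearMap.adjoint_inner_left,
      ContinuousLinearMap.adjoint_inner_left]

theorem diagonalRep_apply [CompleteSpace H] [CompleteSpace K] {A : Type*}
    [NonUnitalCStarAlgebra A] (π : A →⋆ₙₐ[ℂ] (H →L[ℂ] H)) (ρ : A →⋆ₙₐ[ℂ] (K →L[ℂ] K)) (a : A) :
    diagonalRep π ρ a = diagonalOp (π a) (ρ a) := rfl

theorem diagonalOp_mul_offDiagonal (S : H →L[ℂ] H) (S' : K →L[ℂ] K) (T : K →L[ℂ] H) :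
    diagonalOp S S' * offDiagonal T = offDiagonal (S ∘L T) := by
  ext1 z
  refine withLp_prod_ext ?_ ?_
  · rfl
  · exact map_zero S'

theorem offDiagonal_mul_diagonalOp (T : K →L[ℂ] H) (S : H →L[ℂ] H) (S' : K →L[ℂ] K) :
    offDiagonal T * diagonalOp S S' = offDiagonal (T ∘L S') := rfl

/-- The corner operator ignores the `H`-component of its argument, and the norm on `K` is at most
that on `H ⊕ K`. -/
theorem amplifiedBound_offDiagonal_iff {V : Type*} [AddCommGroup V] [Module ℂ V]
    (J : V →ₗ[ℂ] (K →L[ℂ] H)) {r : ℕ} (x : Matrix (Fin r) (Fin r) V) (C : ℝ) :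
    AmplifiedBound (offDiagonal ∘ₗ J) x C ↔ AmplifiedBound J x C := by
  have e : ∀ (k : Fin r) (η : Fin r → WithLp 2 (H × K)),
      ‖∑ l, (offDiagonal ∘ₗ J) (x k l) (η l)‖ ^ 2 = ‖∑ l, J (x k l) (η l).snd‖ ^ 2 := by
    intro k η
    have : ∑ l, (offDiagonal ∘ₗ J) (x k l) (η l) =
        WithLp.toLp 2 (∑ l, J (x k l) (η l).snd, 0) := by
      refine withLp_prod_ext ?_ ?_
      · rw [← WithLp.fstₗ_apply 2 ℂ, map_sum]
        rfl
      · rw [← WithLp.sndₗ_apply 2 ℂ, map_sum]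
        exact Finset.sum_eq_zero fun l _ => rfl
    rw [this, WithLp.prod_norm_sq_eq_of_L2]
    simp
  refine ⟨fun h η => ?_, fun h η => ?_⟩
  · have := h fun l => WithLp.toLp 2 (0, η l)
    simp only [e] at this
    simpa [WithLp.prod_norm_sq_eq_of_L2] using this
  · simp only [e]
    refine (h fun l => (η l).snd).trans (mul_le_mul_of_nonneg_left ?_ (sq_nonneg C))
    refine Finset.sum_le_sum fun l _ => ?_
    rw [WithLp.prod_norm_sq_eq_of_L2]
    exact le_add_of_nonneg_left (sq_nonneg _)

end OffDiagonal

/-! ### Assembling the completely isometric representation -/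

section Main

variable {A : Type u} {B : Type v} {V : Type w} [NonUnitalCStarAlgebra A]
  [NonUnitalCStarAlgebra B] [AddCommGroup V] [Module ℂ V] {X : Bimodule A B V}
  {N : MatrixNorms V}

theorem exists_bimoduleRep_amplifiedBound_iff (h1 : RuanOne X N) (h2 : RuanTwo N)
    (hX : IsEssential X N) :
    ∃ R : BimoduleRep.{u, v, w, max u w, max v w} X,
      ∀ (n : ℕ) (x : Matrix (Fin n) (Fin n) V) (C : ℝ), 0 ≤ C →
        (AmplifiedBound R.J x C ↔ N.norm n x ≤ C) := by
  let _ : PartialOrder A := CStarAlgebra.spectralOrder A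
  let _ : StarOrderedRing A := CStarAlgebra.spectralOrderedRing A
  let _ : PartialOrder B := CStarAlgebra.spectralOrder B
  let _ : StarOrderedRing B := CStarAlgebra.spectralOrderedRing B
  -- One representation per square matrix of positive size; size zero, where the norm vanishes,
  -- needs none.
  have ex : ∀ i : (Σ n : ℕ, Matrix (Fin (n + 1)) (Fin (n + 1)) V),
      ∃ R : BimoduleRep.{u, v, w, u, v} X,
        (∀ (r : ℕ) (x : Matrix (Fin r) (Fin r) V), AmplifiedBound R.J x (N.norm r x)) ∧
        ∀ C : ℝ, 0 ≤ C → AmplifiedBound R.J i.2 C → N.norm (i.1 + 1) i.2 ≤ C :=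
    fun i => exists_bimoduleRep h1 h2 hX i.2
  choose R hR hR' using ex
  refine ⟨{ H := lp (fun i => (R i).H) 2, K := lp (fun i => (R i).K) 2
            π := lpRep fun i => (R i).π, ρ := lpRep fun i => (R i).ρ
            -- Complete contractivity at size one provides the bound uniform in `i`.
            J := lpLinear (fun i => (R i).J) (fun v => N.norm 1 fun _ _ => v)
              fun i v => (hR i 1 _).norm_apply_le (N.norm_nonneg _)
            map_left := fun a x => ?_, map_right := fun x b => ?_ }, fun n x C hC => ?_⟩
  · ext f i
    rw [lpLinear_apply, (R i).map_left]
    rfl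
  · ext f i
    rw [lpLinear_apply, (R i).map_right]
    rfl
  · dsimp only
    rw [amplifiedBound_lpLinear_iff]
    refine ⟨fun h => ?_, fun h i => fun η => (hR i n x η).trans ?_⟩
    · cases n with
      | zero =>
        rw [Subsingleton.elim x 0, N.norm_zero]
        exact hC
      | succ n => exact hR' ⟨n, x⟩ C hC (h ⟨n, x⟩)
    · have := N.norm_nonneg x
      gcongr

theorem BimoduleRep.isCompletelyIsometric_offDiagonal {R : BimoduleRep.{u, v, w, u', v'} X}
    (hR : ∀ (n : ℕ) (x : Matrix (Fin n) (Fin n) V) (C : ℝ), 0 ≤ C →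
      (AmplifiedBound R.J x C ↔ N.norm n x ≤ C)) :
    IsCompletelyIsometric N (offDiagonal ∘ₗ R.J) := by
  intro n x
  refine le_antisymm ?_ ?_
  · rw [norm_matrixOperator_le_iff _ _ (N.norm_nonneg x), amplifiedBound_offDiagonal_iff,
      hR n x _ (N.norm_nonneg x)]
  · rw [← hR n x _ (norm_nonneg _), ← amplifiedBound_offDiagonal_iff,
      ← norm_matrixOperator_le_iff _ _ (norm_nonneg _)]

/-- The other diagonal entries `ρ'` and `π'` are multiplied by the zero blocks of the corner, so
they can be arbitrary representations. -/
theorem BimoduleRep.isBimoduleMorphism_offDiagonal (R : BimoduleRep.{u, v, w, u', v'} X)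
    (ρ' : A →⋆ₙₐ[ℂ] (R.K →L[ℂ] R.K)) (π' : B →⋆ₙₐ[ℂ] (R.H →L[ℂ] R.H)) :
    IsBimoduleMorphism X (diagonalRep R.π ρ') (diagonalRep π' R.ρ) (offDiagonal ∘ₗ R.J) where
  map_left a x := by
    rw [LinearMap.comp_apply, LinearMap.comp_apply, diagonalRep_apply, diagonalOp_mul_offDiagonal,
      R.map_left]
  map_right x b := by
    rw [LinearMap.comp_apply, LinearMap.comp_apply, diagonalRep_apply, offDiagonal_mul_diagonalOp,
      R.map_right]
  map_left_right a x b := by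
    rw [LinearMap.comp_apply, LinearMap.comp_apply, diagonalRep_apply, diagonalRep_apply,
      diagonalOp_mul_offDiagonal, offDiagonal_mul_diagonalOp, R.map_right, R.map_left]

end Main

end OperatorBimodule
end

theorem mainTheorem6 :
    (∀ (A : Type u) (B : Type v) (V : Type w) [NonUnitalCStarAlgebra A] [NonUnitalCStarAlgebra B]
      [AddCommGroup V] [Module ℂ V] (X : OperatorBimodule.Bimodule A B V)
      (N : OperatorBimodule.MatrixNorms V), OperatorBimodule.IsEssential X N →
      ((OperatorBimodule.RuanOne X N ∧ OperatorBimodule.RuanTwo N) ↔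
        ∃ (H : Type (max u v w)) (_ : NormedAddCommGroup H) (_ : InnerProductSpace ℂ H)
          (_ : CompleteSpace H) (π : A →⋆ₙₐ[ℂ] (H →L[ℂ] H)) (ρ : B →⋆ₙₐ[ℂ] (H →L[ℂ] H))
          (J : V →ₗ[ℂ] (H →L[ℂ] H)),
          OperatorBimodule.IsCompletelyIsometric N J ∧
            OperatorBimodule.IsBimoduleMorphism X π ρ J)) ∧
    (∀ (A : Type u) (V : Type w) [NonUnitalCStarAlgebra A] [AddCommGroup V] [Module ℂ V]
      (X : OperatorBimodule.Bimodule A A V) (N : OperatorBimodule.MatrixNorms V),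
      OperatorBimodule.IsEssential X N →
      ((OperatorBimodule.RuanOne X N ∧ OperatorBimodule.RuanTwo N) ↔
        ∃ (H : Type (max u w)) (_ : NormedAddCommGroup H) (_ : InnerProductSpace ℂ H)
          (_ : CompleteSpace H) (π : A →⋆ₙₐ[ℂ] (H →L[ℂ] H)) (J : V →ₗ[ℂ] (H →L[ℂ] H)),
          OperatorBimodule.IsCompletelyIsometric N J ∧
            OperatorBimodule.IsBimoduleMorphism X π π J)) := by
  refine ⟨fun A B V _ _ _ _ X N hX => ⟨?_, ?_⟩, fun A V _ _ _ X N hX => ⟨?_, ?_⟩⟩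
  · rintro ⟨h1, h2⟩
    obtain ⟨R, hR⟩ := OperatorBimodule.exists_bimoduleRep_amplifiedBound_iff h1 h2 hX
    exact ⟨WithLp 2 (R.H × R.K), inferInstance, inferInstance, inferInstance,
      OperatorBimodule.diagonalRep R.π 0, OperatorBimodule.diagonalRep 0 R.ρ,
      OperatorBimodule.offDiagonal ∘ₗ R.J,
      OperatorBimodule.BimoduleRep.isCompletelyIsometric_offDiagonal hR,
      R.isBimoduleMorphism_offDiagonal 0 0⟩
  · rintro ⟨H, _, _, _, π, ρ, J, hJ, hm⟩
    exact ⟨OperatorBimodule.ruanOne_of_isCompletelyIsometric hJ hm,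
      OperatorBimodule.ruanTwo_of_isCompletelyIsometric hJ⟩
  · rintro ⟨h1, h2⟩
    obtain ⟨R, hR⟩ := OperatorBimodule.exists_bimoduleRep_amplifiedBound_iff h1 h2 hX
    exact ⟨WithLp 2 (R.H × R.K), inferInstance, inferInstance, inferInstance,
      -- Filling the free diagonal entries with `R.ρ` and `R.π` makes the left and right
      -- representations coincide.
      OperatorBimodule.diagonalRep R.π R.ρ, OperatorBimodule.offDiagonal ∘ₗ R.J,
      OperatorBimodule.BimoduleRep.isCompletelyIsometric_offDiagonal hR,
      R.isBimoduleMorphism_offDiagonal R.ρ R.π⟩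
  · rintro ⟨H, _, _, _, π, J, hJ, hm⟩
    exact ⟨OperatorBimodule.ruanOne_of_isCompletelyIsometric hJ hm,
      OperatorBimodule.ruanTwo_of_isCompletelyIsometric hJ⟩
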